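/- Let $\mathbb{K}$ be an algebraically closed field of arbitrary characteristic and let $f\in\mathbb{K}[[x,y]]$ be reduced (square-free) and not a unit times $x$ or a unit times $y$. **Newton tree.** Let $S_1,\dots,S_k$ be the compact edges of the Newton polygon of $f$, from top to bottom, $S_i$ lying on $p_iX+q_iY=N_i$ with $p_i,q_i\ge 1$ coprime. The tree contains a vertical chain of vertices $v_1,\dots,v_k$ with multiplicities $N_{v_i}=N_i$; near $v_i$ the upward edge is decorated by $q_i$ and the downward edge by $p_i$. The chain ends at the top and at the bottom in arrowheads decorated by $(i_0)$ and $(j_0)$, where $x^{i_0}$ and $y^{j_0}$ are the largest powers of $x,y$ dividing $f$. Write the face polynomial of $S_i$ as $c\,x^{n_i}y^{m_i}\prod_j(x^{q_i}-\mu_{ij}y^{p_i})^{\nu_{ij}}$ with $c\neq0$, distinct $\mu_{ij}\ne 0$ and $\nu_{ij}\ge1$. For each $j$ with $\nu_{ij}=1$ attach an arrowhead to the right of $v_i$. For each $j$ with $\nu_{ij}>1$ form the Hamburger–Noether transform $f_{ij}(X,Y)=f\bigl(X^{p_i}(Y+\bar\mu)^{q'},X^{q_i}(Y+\bar\mu)^{p'}\bigr)$,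 where $x=X^{p_i}Y^{q'}$, $y=X^{q_i}Y^{p'}$ is the composition of the blow-ups prescribed by the Euclidean algorithm for $(p_i,q_i)$, and $\bar\mu=\mu_{ij}^{\mp1}$ according to $p_ip'-q_iq'=\pm1$; repeat the construction for the Newton polygon of $f_{ij}$, whose points all have $X\ge N_i$, and glue its chain, without top arrowhead, to the right of $v_i$, replacing each upward decoration $q'_s$ of the chain by $q'_s+p_iq_ip'_s$ (here $q_i$ is the decoration of $v_i$ after its own replacement). **Multiplicity of the tree.** Let $\mathcal V$ be the set of vertices, $\mathscr A_0$ the set of arrowheads decorated by $(0)$ and $\delta_v$ the valency of $v$. An arrowhead $v'\in\mathscr A_0$ attached to a vertex $v$ by an edge decorated by $a$ near $v$ has $N_{v'}:=N_v/a$ (an arrowhead that is not attached to a vertex is not counted). Put $M(\mathcal T):=-\sum_{v\in\mathcal V\cup\mathscr A_0}N_v(\delta_v-2)$. **Areas and traces.** If a Newton polygon does not hit the $X$-axis but ends on $Y=1$ at $(c,1)$, its horizontal edge is replaced by an edge from $(c,1)$ to a lattice point $(n,0)$, $n>c$, such that no point of the support lies below the line through these points; similarly for the $Y$-axis. Let $\mathcal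 A_0$ be the area between the axes and the resulting polygon of $f$, with traces $(a,0)$ and $(0,b)$ on the axes. Let $\ell$ run through all Hamburger–Noether transforms $f_\ell$ made in the construction, $N_\ell$ being the multiplicity of the vertex at which the transform is made. Let $\mathcal A_\ell$ be the area between the resulting polygon of $f_\ell$, the line $X=N_\ell$ and the $X$-axis, and let $(a_\ell+N_\ell,0)$ be its trace on the $X$-axis. **Theorem.** The construction ends after finitely many steps, so that $f$ has a (finite) Newton tree $\mathcal T$; all these polygons have traces as described; and for every choice of the replaced edges, $$-M(\mathcal T)=2\mathcal A_0-a-b+\sum_{\ell}(2\mathcal A_\ell-a_\ell).$$ No nondegeneracy hypothesis on $f$ is needed. -/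

import Mathlib

noncomputable section

namespace NewtonTrees

/-! ### Power series in two variables and their Newton polygons -/

/-- The ring `K[[x, y]]`; the variable `x` has index `0` and `y` has index `1`. -/
abbrev Series (K : Type*) [Field K] := MvPowerSeries (Fin 2) K

/-- The exponent of the monomial `x ^ i * y ^ j`. -/
def expo (i j : ℕ) : Fin 2 →₀ ℕ := Finsupp.single 0 i + Finsupp.single 1 j

/-- The set of exponents `(i, j)` of the monomials that occur in `f`. -/
def supp {K : Type*} [Field K] (f : Series K) : Set (ℕ × ℕ) :=
  {z | MvPowerSeries.coeff (expo z.1 z.2) f ≠ 0}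

/-- The largest power of `x` dividing `f` (for `f ≠ 0`). -/
def ordX {K : Type*} [Field K] (f : Series K) : ℕ := sInf {i | ∃ j, (i, j) ∈ supp f}

/-- The largest power of `y` dividing `f` (for `f ≠ 0`). -/
def ordY {K : Type*} [Field K] (f : Series K) : ℕ := sInf {j | ∃ i, (i, j) ∈ supp f}

/-- The minimum `N` of the linear form `p X + q Y` on the support of `f`. -/
def weight {K : Type*} [Field K] (p q : ℕ) (f : Series K) : ℕ :=
  sInf {N | ∃ z ∈ supp f, N = p * z.1 + q * z.2}

/-- `(p, q)` is the normal direction of a compact edge of the Newton polygon of `f`: the edge is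
supported by the line `p X + q Y = N` with `p, q ≥ 1` coprime, and contains at least two points of
the support. -/
def IsEdge {K : Type*} [Field K] (f : Series K) (e : ℕ × ℕ) : Prop :=
  0 < e.1 ∧ 0 < e.2 ∧ Nat.Coprime e.1 e.2 ∧
    ∃ z ∈ supp f, ∃ w ∈ supp f, z ≠ w ∧
      e.1 * z.1 + e.2 * z.2 = weight e.1 e.2 f ∧ e.1 * w.1 + e.2 * w.2 = weight e.1 e.2 f

/-- `es` lists the compact edges of the Newton polygon of `f` from top to bottom, that is, with
`p₁ / q₁ > p₂ / q₂ > ⋯`. -/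
def IsEdgeList {K : Type*} [Field K] (f : Series K) (es : List (ℕ × ℕ)) : Prop :=
  (∀ e, e ∈ es ↔ IsEdge f e) ∧ es.Pairwise fun e e' => e'.1 * e.2 < e.1 * e'.2

/-- The part of `f` supported on the face on which `p X + q Y` is minimal. -/
def faceForm {K : Type*} [Field K] (p q : ℕ) (f : Series K) : Series K :=
  fun d => if p * d 0 + q * d 1 = weight p q f then MvPowerSeries.coeff d f else 0

/-- The factorization `c x ^ a y ^ b ∏ⱼ (x ^ q - μⱼ y ^ p) ^ νⱼ` of the face polynomial, with
distinct nonzero `μⱼ` and exponents `νⱼ ≥ 1`. -/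
def IsFaceFactorization {K : Type*} [Field K] (p q : ℕ) (f : Series K) {n : ℕ}
    (μ : Fin n → K) (ν : Fin n → ℕ) : Prop :=
  Function.Injective μ ∧ (∀ j, μ j ≠ 0) ∧ (∀ j, 0 < ν j) ∧
    ∃ (c : K) (a b : ℕ), c ≠ 0 ∧
      faceForm p q f = MvPowerSeries.C c * MvPowerSeries.X 0 ^ a * MvPowerSeries.X 1 ^ b *
        ∏ j, (MvPowerSeries.X 0 ^ q - MvPowerSeries.C (μ j) * MvPowerSeries.X 1 ^ p) ^ ν j

/-! ### Hamburger–Noether transforms -/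

/-- The exponents `(p', q')` such that the composition of the blow-ups prescribed by the Euclidean
algorithm for `(p, q)` is `x = X ^ p * Y ^ q'`, `y = X ^ q * Y ^ p'`. If `p ≥ q`, one starts with
`x = x₁ * y₁ ^ k`, `y = y₁`, where `k = p / q`, and goes on with `(p % q, q)`; if `p < q`, with
`x = x₁`, `y = x₁ ^ k * y₁`, where `k = q / p`, and goes on with `(p, q % p)`. At the end, one has
`(x, y) = (Y, X)` for `(0, 1)` and `(x, y) = (X, Y)` for `(1, 0)`. -/
def hnExp (p q : ℕ) : ℕ × ℕ :=
  if p = 0 then (0, 1)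
  else if q = 0 then (1, 0)
  else if q ≤ p then
    let e := hnExp (p % q) q
    (e.1, e.2 + (p / q) * e.1)
  else
    let e := hnExp p (q % p)
    (e.1 + (q / p) * e.2, e.2)
termination_by p + q
decreasing_by
  · have := Nat.mod_lt p (Nat.pos_of_ne_zero ‹¬ q = 0›); omega
  · have := Nat.mod_lt q (Nat.pos_of_ne_zero ‹¬ p = 0›); omega

/-- The value `μ⁻¹` or `μ` of `Y` on the strict transform of `x ^ q = μ * y ^ p`, according to
`p * p' - q * q' = 1` or `p * p' - q * q' = -1`. -/
def hnRoot {K : Type*} [Field K] (p q : ℕ) (μ : K) : K :=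
  if q * (hnExp p q).2 < p * (hnExp p q).1 then μ⁻¹ else μ

/-- The Hamburger–Noether transform of `f` at the root `μ` of its `(p, q)`-edge: with
`s = μ` or `μ⁻¹`, substitute `x = X ^ p * (Y + s) ^ q'`, `y = X ^ q * (Y + s) ^ p'`. -/
def hnTransform {K : Type*} [Field K] (p q : ℕ) (μ : K) (f : Series K) : Series K :=
  MvPowerSeries.subst
    ![(MvPowerSeries.X 0 ^ p *
        (MvPowerSeries.X 1 + MvPowerSeries.C (hnRoot p q μ)) ^ (hnExp p q).2 : Series K),
      MvPowerSeries.X 0 ^ q *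
        (MvPowerSeries.X 1 + MvPowerSeries.C (hnRoot p q μ)) ^ (hnExp p q).1] f

/-! ### Newton trees -/

/-- What hangs from an edge of a Newton tree, seen from its upper (or left) end: an arrowhead with
its decoration (`0` for the arrowheads decorated by `(0)`, `1` for the other ones), or a vertex
with its multiplicity `N`, the decoration `q` near it on the edge that leads to it, the decoration
`p` near it on the edge going down, the subtrees `right j` attached to the `n` edges going to the
right (decorated by `1` near the vertex), and the subtree `below` attached to the edge going
down. -/
inductive Subtree : Type
  | arrow (m : ℕ) : Subtree
  | vertex (N p q : ℕ) (n : ℕ) (right : Fin n → Subtree) (below : Subtree) : Subtree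

/-- A Newton tree: the decoration of its top arrowhead, and what hangs from the edge going down
from that arrowhead. -/
structure NewtonTree : Type where
  top : ℕ
  body : Subtree

/-- If `t` is an arrowhead decorated by `(0)`, attached to a vertex of multiplicity `N` by an edge
with decoration `a` near that vertex, then its multiplicity is `N / a` and its valency is `1`;
this is its summand `(N / a) * (1 - 2)`. It is `0` if `t` is not such an arrowhead. -/
def deadEndTerm (N a : ℕ) : Subtree → ℚ
  | .arrow 0 => ((N : ℚ) / a) * (1 - 2)
  | _ => 0

/-- The sum of `N_v * (δ_v - 2)` over the vertices `v` of a subtree and over the arrowheads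
decorated by `(0)` that are attached to them from below or from the right. The valency of a vertex
is `δ_v = n + 2`: there are `n` edges to the right, one going down, and one leading to `v`. -/
def Subtree.sum : Subtree → ℚ
  | .arrow _ => 0
  | .vertex N p _ n right below =>
      (N : ℚ) * (((n + 2 : ℕ) : ℚ) - 2) + deadEndTerm N p below + below.sum +
        ∑ j, (deadEndTerm N 1 (right j) + (right j).sum)

/-- The summand of the top arrowhead, if it is decorated by `(0)` and attached to a vertex. -/
def NewtonTree.topTerm (T : NewtonTree) : ℚ :=
  match T.body with
  | .arrow _ => 0
  | .vertex N _ q _ _ _ => deadEndTerm N q (.arrow T.top)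

/-- The multiplicity of a tree: minus the sum of `N_v * (δ_v - 2)` over all vertices and all
arrowheads decorated by `(0)`. -/
def NewtonTree.multiplicity (T : NewtonTree) : ℚ := -(T.topTerm + T.body.sum)

/-- `IsChain D g es t L`: the vertical linear tree of the edges `es` (a final segment of the list
of edges of `g`, from top to bottom), with everything attached to it to the right, is `t`, and `L`
collects, as pairs `(N, h)`, all Hamburger–Noether transforms `h` made in building `t`; here `h`
is the transform at a root of an edge supported by a line `p X + q Y = N`.

The decorations `q` are replaced by `q + D * p`, where `D = 0` for the first Newton polygon, and
`D = p₀ * q₀` if the tree is glued to a vertex with decorations `p₀, q₀`. A factor of multiplicity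
`1` of a face polynomial gives an arrowhead, one of multiplicity `> 1` gives the tree of the
corresponding transform. -/
inductive IsChain {K : Type*} [Field K] :
    ℕ → Series K → List (ℕ × ℕ) → Subtree → Multiset (ℕ × Series K) → Prop
  | nil (D : ℕ) (g : Series K) : IsChain D g [] (.arrow (ordY g)) 0
  | cons (D : ℕ) (g : Series K) (p q : ℕ) (es : List (ℕ × ℕ)) (n : ℕ)
      (μ : Fin n → K) (ν : Fin n → ℕ) (right : Fin n → Subtree) (below : Subtree)
      (es' : Fin n → List (ℕ × ℕ)) (L' : Fin n → Multiset (ℕ × Series K))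
      (L : Multiset (ℕ × Series K))
      (hface : IsFaceFactorization p q g μ ν)
      (hone : ∀ j, ν j = 1 → right j = .arrow 1)
      (hedges : ∀ j, 1 < ν j → IsEdgeList (hnTransform p q (μ j) g) (es' j))
      (hglue : ∀ j, 1 < ν j →
        IsChain (p * (q + D * p)) (hnTransform p q (μ j) g) (es' j) (right j) (L' j))
      (hbelow : IsChain D g es below L) :
      IsChain D g ((p, q) :: es) (.vertex (weight p q g) p (q + D * p) n right below)
        (L + ∑ j, if 1 < ν j then (weight p q g, hnTransform p q (μ j) g) ::ₘ L' j else 0)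

/-- `T` is the Newton tree of `f`, and `L` is the family of all Hamburger–Noether transforms
`(N_ℓ, f_ℓ)` made in its construction, counted with repetitions. -/
def IsNewtonTree {K : Type*} [Field K] (f : Series K) (T : NewtonTree)
    (L : Multiset (ℕ × Series K)) : Prop :=
  ∃ es, IsEdgeList f es ∧ T.top = ordX f ∧ IsChain 0 f es T.body L

/-! ### Areas and traces -/

/-- The convex hull of `S + ℝ≥0 ^ 2`, whose boundary is the Newton polygon. -/
def newtonPolyhedron (S : Set (ℕ × ℕ)) : Set (ℝ × ℝ) :=
  convexHull ℝ {z | ∃ s ∈ S, (s.1 : ℝ) ≤ z.1 ∧ (s.2 : ℝ) ≤ z.2}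

/-- The area of the region between the Newton polygon of `S`, the line `X = N` and the `X`-axis
`Y = 0`. -/
def areaFrom (N : ℕ) (S : Set (ℕ × ℕ)) : ℝ :=
  (MeasureTheory.volume ({z : ℝ × ℝ | (N : ℝ) ≤ z.1 ∧ 0 ≤ z.2} \ newtonPolyhedron S)).toReal

/-- `n` is a trace on the `X`-axis of the Newton polygon of `S`. If the polygon hits the `X`-axis,
it does so in `(n, 0)`. Otherwise the polygon ends on the line `Y = 1` in a point `(c, 1)`, and
the horizontal edge starting there is replaced by an edge from `(c, 1)` to `(n, 0)`, where `c < n`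
and convexity holds: the points of `S` lie on or above the line through `(c, 1)` and `(n, 0)`. -/
def IsXTrace (S : Set (ℕ × ℕ)) (n : ℕ) : Prop :=
  IsLeast {k | (k, 0) ∈ S} n ∨
    (∀ k, (k, 0) ∉ S) ∧ ∃ c, IsLeast {k | (k, 1) ∈ S} c ∧ c < n ∧
      ∀ z ∈ S, n ≤ z.1 + (n - c) * z.2

/-- `m` is a trace on the `Y`-axis of the Newton polygon of `S`; the same notion with the two axes
exchanged. -/
def IsYTrace (S : Set (ℕ × ℕ)) (m : ℕ) : Prop := IsXTrace (Prod.swap ⁻¹' S) m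

end NewtonTrees

end

noncomputable section

namespace NewtonTrees

open MvPowerSeries

variable {K : Type*} [Field K]

/-! ### Coefficients of power series in two variables -/

/-! The formula compares two ways of summing over edges. For an edge from `(x, b + p r)` to `(x + q
r, b)`, its multiplicity times its lattice length `r` is twice the area of the triangle it spans
with the origin. Comparing with the trapezoids below the edges and telescoping, a polygon from `(N,
e)` down to `(x', y')` satisfies `2 * area + N * e = ∑ Nᵢ rᵢ + x' * y'` (`EdgeChain.hasArea`); a
replaced edge adds one more strip.

On the tree side, a vertex with `n` edges to the right contributes `N * n`, and the root
multiplicities satisfy `∑ νⱼ = r`. The transform at a root of multiplicity `ν` is `X ^ N * (Y ^ ν *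
unit + X * _)` (`IsFaceFactorization.hasForm_hnTransform`), so its polygon starts at `(N, ν)`. By
the identity above and induction, the subtree glued there contributes `N * (ν - 1)` plus the area
terms of that transform and its descendants. A vertex with all that hangs to its right thus gives `N
* r` plus area terms (`IsChain.sum_eq`). Dead ends supply the traces on axes that the polygon hits.
Only the multiplicities of the roots enter, which is why no nondegeneracy is needed.

Finiteness rests on reducedness in a form that survives the substitutions in every characteristic: a
power of `x y` lies in the ideal of `f`, `x ∂f/∂x`, `y ∂f/∂y` (`logReduced_of_squarefree`). The
substitution acts on logarithmic derivations by a matrix of determinant `±1`, so the property passes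
to transforms (`LogReduced.hnTransform`) and forbids square factors other than divisors of powers of
`X`. Along an infinite branch the orders satisfy `p * e' ≤ e`; they stabilise at some `d ≥ 2`, after
which `p = 1`, and the successive centres define a series `φ(x)` such that `(y - φ(x)) ^ 2` is a
factor (`exists_sq_dvd_of_hasForm`), a contradiction. -/

@[simp] theorem expo_zero (i j : ℕ) : expo i j 0 = i := by simp [expo]

@[simp] theorem expo_one (i j : ℕ) : expo i j 1 = j := by simp [expo]

theorem expo_eta (d : Fin 2 →₀ ℕ) : expo (d 0) (d 1) = d := by
  ext i; fin_cases i <;> simp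

theorem expo_le_iff {a b i j : ℕ} : expo a b ≤ expo i j ↔ a ≤ i ∧ b ≤ j := by
  rw [Finsupp.le_def]; simp [Fin.forall_fin_two]

theorem expo_inj {a b i j : ℕ} : expo a b = expo i j ↔ a = i ∧ b = j := by
  constructor
  · intro h
    exact ⟨by simpa using DFunLike.congr_fun h 0, by simpa using DFunLike.congr_fun h 1⟩
  · rintro ⟨rfl, rfl⟩; rfl

theorem expo_sub (a b i j : ℕ) : expo i j - expo a b = expo (i - a) (j - b) := by
  ext k; fin_cases k <;> simp

theorem expo_add (a b i j : ℕ) : expo i j + expo a b = expo (i + a) (j + b) := by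
  ext k; fin_cases k <;> simp

theorem expo_zero_zero : expo 0 0 = 0 := by simp [expo]

/-- The coefficient of `x ^ i * y ^ j`. -/
def cf (i j : ℕ) : Series K →ₗ[K] K := MvPowerSeries.coeff (expo i j)

theorem cf_apply (i j : ℕ) (f : Series K) : cf i j f = MvPowerSeries.coeff (expo i j) f := rfl

theorem mem_supp {f : Series K} {z : ℕ × ℕ} : z ∈ supp f ↔ cf z.1 z.2 f ≠ 0 := Iff.rfl

theorem series_ext {f g : Series K} (h : ∀ i j, cf i j f = cf i j g) : f = g := by
  ext d
  rw [← expo_eta d]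
  exact h _ _

/-- The power series with given coefficients. -/
def ofCf (c : ℕ → ℕ → K) : Series K := fun d => c (d 0) (d 1)

@[simp] theorem cf_ofCf (c : ℕ → ℕ → K) (i j : ℕ) : cf i j (ofCf c) = c i j := by
  rw [cf_apply, MvPowerSeries.coeff_apply, ofCf]; simp

theorem monomial_expo (a b : ℕ) (c : K) :
    MvPowerSeries.monomial (expo a b) c = (C c * X 0 ^ a * X 1 ^ b : Series K) := by
  rw [X_pow_eq, X_pow_eq, ← monomial_zero_eq_C_apply, monomial_mul_monomial, monomial_mul_monomial]
  simp [expo]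

theorem cf_X_pow_mul (a b i j : ℕ) (f : Series K) :
    cf i j (X 0 ^ a * X 1 ^ b * f) = if a ≤ i ∧ b ≤ j then cf (i - a) (j - b) f else 0 := by
  have h := monomial_expo a b (1 : K)
  rw [map_one C, one_mul] at h
  rw [← h, cf_apply, coeff_monomial_mul]
  simp only [expo_le_iff, expo_sub, one_mul, cf_apply]

theorem cf_X0_pow_mul (a i j : ℕ) (f : Series K) :
    cf i j (X 0 ^ a * f) = if a ≤ i then cf (i - a) j f else 0 := by
  simpa using cf_X_pow_mul a 0 i j f

theorem cf_X1_pow_mul (b i j : ℕ) (f : Series K) :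
    cf i j (X 1 ^ b * f) = if b ≤ j then cf i (j - b) f else 0 := by
  simpa using cf_X_pow_mul 0 b i j f

theorem cf_C_mul (i j : ℕ) (c : K) (f : Series K) : cf i j (C c * f) = c * cf i j f := by
  rw [cf_apply, coeff_C_mul, cf_apply]

theorem cf_C (i j : ℕ) (c : K) : cf i j (C c : Series K) = if i = 0 ∧ j = 0 then c else 0 := by
  classical
  rw [cf_apply, coeff_C, ← expo_zero_zero]
  simp only [expo_inj]

theorem cf_zero_zero (f : Series K) : cf 0 0 f = constantCoeff f := by
  rw [cf_apply, expo_zero_zero, coeff_zero_eq_constantCoeff_apply]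

theorem isUnit_iff_cf {f : Series K} : IsUnit f ↔ cf 0 0 f ≠ 0 := by
  rw [MvPowerSeries.isUnit_iff_constantCoeff, isUnit_iff_ne_zero, cf_zero_zero]

theorem X0_pow_dvd_iff {n : ℕ} {f : Series K} :
    X 0 ^ n ∣ f ↔ ∀ i j, i < n → cf i j f = 0 := by
  rw [X_pow_dvd_iff]
  constructor
  · intro h i j hi
    exact h _ (by simpa using hi)
  · intro h d hd
    rw [← expo_eta d]
    exact h _ _ hd

theorem X1_pow_dvd_iff {n : ℕ} {f : Series K} :
    X 1 ^ n ∣ f ↔ ∀ i j, j < n → cf i j f = 0 := by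
  rw [X_pow_dvd_iff]
  constructor
  · intro h i j hi
    exact h _ (by simpa using hi)
  · intro h d hd
    rw [← expo_eta d]
    exact h _ _ hd

theorem supp_nonempty {f : Series K} (hf : f ≠ 0) : (supp f).Nonempty := by
  by_contra h
  apply hf
  refine series_ext fun i j => ?_
  by_contra h'
  exact h ⟨(i, j), by simpa [mem_supp] using h'⟩

theorem eq_zero_of_forall_X0_pow_dvd {f : Series K} (h : ∀ n, X 0 ^ n ∣ f) : f = 0 :=
  series_ext fun i j => by simpa using X0_pow_dvd_iff.mp (h (i + 1)) i j (Nat.lt_succ_self i)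

/-- Every power series is `c + x * a + y * b`, where `b` does not involve `x`. -/
theorem exists_decomposition (f : Series K) :
    f = C (cf 0 0 f) + X 0 * ofCf (fun i j => cf (i + 1) j f) +
      X 1 * ofCf (fun i j => if i = 0 then cf 0 (j + 1) f else 0) := by
  refine series_ext fun i j => ?_
  have h0 := cf_X0_pow_mul 1 i j (ofCf (fun i j => cf (i + 1) j f))
  have h1 := cf_X1_pow_mul 1 i j (ofCf (fun i j => if i = 0 then cf 0 (j + 1) f else 0))
  rw [pow_one] at h0 h1
  rw [map_add, map_add, h0, h1, cf_C]
  rcases i with _ | i <;> rcases j with _ | j <;> simp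

/-! ### The form `x ^ N * (y ^ e * unit + x * g)` -/

/-- `f` is `x ^ N` times a power series whose restriction to `x = 0` has order `e`. -/
def HasForm (f : Series K) (N e : ℕ) : Prop :=
  ∃ U G : Series K, IsUnit U ∧ f = X 0 ^ N * (X 1 ^ e * U + X 0 * G)

/-- Geometrically, `N` is the leftmost column of the support and `(N, e)` its lowest point there,
that is, the top vertex of the Newton polygon. The product form suits substitutions, the coefficient
form suits polygons. -/
theorem hasForm_iff {f : Series K} {N e : ℕ} :
    HasForm f N e ↔ (∀ i j, i < N → cf i j f = 0) ∧ (∀ j, j < e → cf N j f = 0) ∧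
      cf N e f ≠ 0 := by
  constructor
  · rintro ⟨U, G, hU, rfl⟩
    have h : ∀ j, cf N j (X 0 ^ N * (X 1 ^ e * U + X 0 * G)) =
        if e ≤ j then cf 0 (j - e) U else 0 := by
      intro j
      have h0 := cf_X0_pow_mul 1 0 j G
      rw [pow_one] at h0
      rw [cf_X0_pow_mul, if_pos le_rfl, Nat.sub_self, map_add, cf_X1_pow_mul, h0]
      simp
    refine ⟨fun i j hi => X0_pow_dvd_iff.mp (Dvd.intro _ rfl) i j hi, fun j hj => ?_, ?_⟩
    · rw [h, if_neg (by omega)]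
    · rw [h, if_pos le_rfl, Nat.sub_self]
      exact isUnit_iff_cf.mp hU
  · rintro ⟨h1, h2, h3⟩
    refine ⟨ofCf fun i j => if i = 0 then cf N (j + e) f else 0,
      ofCf fun i j => cf (N + 1 + i) j f, ?_, ?_⟩
    · rw [isUnit_iff_cf]; simpa using h3
    · refine series_ext fun i j => ?_
      rw [cf_X0_pow_mul]
      split_ifs with hi
      · have h0 := cf_X0_pow_mul 1 (i - N) j (ofCf fun i j => cf (N + 1 + i) j f)
        rw [pow_one] at h0
        rw [map_add, h0, cf_X1_pow_mul]
        simp only [cf_ofCf]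
        rcases Nat.eq_or_lt_of_le hi with rfl | hi
        · simp only [Nat.sub_self, if_true, if_neg (show ¬ 1 ≤ 0 by omega), add_zero]
          split_ifs with hj
          · rw [Nat.sub_add_cancel hj]
          · exact h2 j (by omega)
        · rw [if_pos (by omega : 1 ≤ i - N), if_neg (by omega : ¬ i - N = 0), ite_self, zero_add]
          congr 2; omega
      · exact h1 i j (by omega)

theorem HasForm.ne_zero {f : Series K} {N e : ℕ} (h : HasForm f N e) : f ≠ 0 := by
  rintro rfl
  exact (hasForm_iff.mp h).2.2 (by simp)

theorem exists_hasForm {f : Series K} (hf : f ≠ 0) : ∃ N e, HasForm f N e := by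
  classical
  have h : ∃ i, ∃ j, cf i j f ≠ 0 := by
    obtain ⟨z, hz⟩ := supp_nonempty hf
    exact ⟨_, _, hz⟩
  have h' := Nat.find_spec h
  refine ⟨Nat.find h, Nat.find h', hasForm_iff.mpr ⟨fun i j hi => ?_, fun j hj => ?_,
    Nat.find_spec h'⟩⟩
  · have := Nat.find_min h hi
    push Not at this
    exact this j
  · have := Nat.find_min h' hj
    push Not at this
    exact this

theorem HasForm.unique {f : Series K} {N e N' e' : ℕ} (h : HasForm f N e) (h' : HasForm f N' e') :
    N = N' ∧ e = e' := by
  rw [hasForm_iff] at h h'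
  have hN : N = N' := by
    rcases lt_trichotomy N N' with hl | hl | hl
    · exact absurd (h'.1 N e hl) h.2.2
    · exact hl
    · exact absurd (h.1 N' e' hl) h'.2.2
  subst hN
  refine ⟨rfl, ?_⟩
  rcases lt_trichotomy e e' with hl | hl | hl
  · exact absurd (h'.2.1 e hl) h.2.2
  · exact hl
  · exact absurd (h.2.1 e' hl) h'.2.2

theorem HasForm.mul {f g : Series K} {N e M d : ℕ} (hf : HasForm f N e) (hg : HasForm g M d) :
    HasForm (f * g) (N + M) (e + d) := by
  obtain ⟨U, G, hU, rfl⟩ := hf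
  obtain ⟨V, H, hV, rfl⟩ := hg
  exact ⟨U * V, X 1 ^ e * U * H + G * (X 1 ^ d * V) + X 0 * G * H, hU.mul hV, by ring⟩

theorem HasForm.of_mul_left {f g : Series K} {N e M d : ℕ} (hf : HasForm f N e)
    (hfg : HasForm (f * g) M d) : N ≤ M ∧ e ≤ d ∧ HasForm g (M - N) (d - e) := by
  have hg : g ≠ 0 := by
    rintro rfl
    exact hfg.ne_zero (mul_zero _)
  obtain ⟨N', e', h⟩ := exists_hasForm hg
  obtain ⟨rfl, rfl⟩ := hfg.unique (hf.mul h)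
  exact ⟨by omega, by omega, by simpa using h⟩

theorem HasForm.dvd {f : Series K} {N e : ℕ} (hf : HasForm f N e) : X 0 ^ N ∣ f := by
  obtain ⟨U, G, -, rfl⟩ := hf
  exact Dvd.intro _ rfl

theorem HasForm.le_of_dvd {f : Series K} {N e n : ℕ} (hf : HasForm f N e) (h : X 0 ^ n ∣ f) :
    n ≤ N := by
  by_contra h'
  exact (hasForm_iff.mp hf).2.2 (X0_pow_dvd_iff.mp h N e (by omega))

theorem hasForm_X0_pow (n : ℕ) : HasForm (X 0 ^ n : Series K) n 0 :=
  ⟨1, 0, isUnit_one, by simp⟩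

theorem IsUnit.hasForm {U : Series K} (hU : IsUnit U) : HasForm U 0 0 :=
  ⟨U, 0, hU, by simp⟩

theorem HasForm.isUnit {U : Series K} (hU : HasForm U 0 0) : IsUnit U :=
  isUnit_iff_cf.mpr (hasForm_iff.mp hU).2.2

theorem HasForm.not_dvd_X0_pow {w : Series K} {N e : ℕ} (hw : HasForm w N e) (he : 0 < e) (n : ℕ) :
    ¬ w ∣ X 0 ^ n := by
  rintro ⟨b, hb⟩
  have h := hasForm_X0_pow (K := K) n
  rw [hb] at h
  have := (hw.of_mul_left h).2.1
  omega

/-! ### Weierstrass division -/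

/-- Division by `y ^ e`, forgetting the terms of degree less than `e` in `y`. -/
def shiftY (e : ℕ) (f : Series K) : Series K := ofCf fun i j => cf i (j + e) f

@[simp] theorem cf_shiftY (e i j : ℕ) (f : Series K) : cf i j (shiftY e f) = cf i (j + e) f := by
  simp [shiftY]

theorem shiftY_sub (e : ℕ) (f g : Series K) : shiftY e (f - g) = shiftY e f - shiftY e g :=
  series_ext fun i j => by simp

theorem X0_pow_dvd_shiftY {e n : ℕ} {f : Series K} (h : X 0 ^ n ∣ f) : X 0 ^ n ∣ shiftY e f := by
  rw [X0_pow_dvd_iff] at h ⊢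
  intro i j hi
  rw [cf_shiftY]
  exact h _ _ hi

/-- The right-hand side is a contraction for the `x`-adic metric, since the factor `X 0` gains one
order at each application; the solution is the limit of the iterates of `0`. -/
theorem exists_eq_shiftY_sub_mul (e : ℕ) (h G : Series K) :
    ∃ a, a = shiftY e (h - X 0 * G * a) := by
  let T : Series K → Series K := fun a => shiftY e (h - X 0 * G * a)
  have hT : ∀ n a b, X 0 ^ n ∣ a - b → X 0 ^ (n + 1) ∣ T a - T b := by
    intro n a b hab
    change X 0 ^ (n + 1) ∣ shiftY e _ - shiftY e _
    rw [← shiftY_sub]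
    apply X0_pow_dvd_shiftY
    obtain ⟨c, hc⟩ := hab
    refine ⟨-(G * c), ?_⟩
    have : h - X 0 * G * a - (h - X 0 * G * b) = -(X 0 * G * (a - b)) := by ring
    rw [this, hc]; ring
  let s : ℕ → Series K := fun n => T^[n] 0
  have hs : ∀ n, s (n + 1) = T (s n) := fun n => Function.iterate_succ_apply' T n 0
  have h1 : ∀ n, X 0 ^ n ∣ s (n + 1) - s n := by
    intro n
    induction n with
    | zero => simp
    | succ n ih => rw [hs (n + 1), hs n]; exact hT n _ _ (by rw [← hs n]; exact ih)
  have h2 : ∀ n m, X 0 ^ n ∣ s (n + m) - s n := by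
    intro n m
    induction m with
    | zero => simp
    | succ m ih =>
      have := dvd_add ((pow_dvd_pow _ (Nat.le_add_right n m)).trans (h1 (n + m))) ih
      rwa [sub_add_sub_cancel] at this
  -- The coefficients with exponent `i` in `x` no longer change from the iterate `i + 1` on.
  let a : Series K := ofCf fun i j => cf i j (s (i + 1))
  have ha : ∀ n, X 0 ^ n ∣ a - s n := by
    intro n
    rw [X0_pow_dvd_iff]
    intro i j hi
    have := X0_pow_dvd_iff.mp (h2 (i + 1) (n - (i + 1))) i j (Nat.lt_succ_self i)
    rw [show i + 1 + (n - (i + 1)) = n by omega, map_sub] at this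
    rw [map_sub, show cf i j a = cf i j (s (i + 1)) from cf_ofCf _ _ _, ← neg_sub, this, neg_zero]
  refine ⟨a, ?_⟩
  rw [← sub_eq_zero]
  refine eq_zero_of_forall_X0_pow_dvd fun n => ?_
  have := dvd_sub (ha (n + 1)) (hT n _ _ (ha n))
  rw [hs n] at this
  have h' : a - T (s n) - (T a - T (s n)) = a - T a := by ring
  rw [h'] at this
  exact (pow_dvd_pow _ (Nat.le_succ n)).trans this

/-- Weierstrass division. -/
theorem exists_weierstrass_division {w : Series K} {e : ℕ} (hw : HasForm w 0 e) (h : Series K) :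
    ∃ a r, h = w * a + r ∧ ∀ i j, e ≤ j → cf i j r = 0 := by
  obtain ⟨U, G, hU, rfl⟩ := hw
  obtain ⟨V, hV⟩ := hU.exists_right_inv
  obtain ⟨a, ha⟩ := exists_eq_shiftY_sub_mul e h (G * V)
  -- As `w * V = y ^ e + x * G * V`, the quotient is `V * a`, and the fixed-point equation says that
  -- the remainder has no term of degree at least `e` in `y`.
  refine ⟨V * a, h - X 0 * (G * V) * a - X 1 ^ e * a, ?_, fun i j hj => ?_⟩
  · linear_combination (-X 1 ^ e * a) * hV
  · have := congrArg (cf i (j - e)) ha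
    rw [cf_shiftY, Nat.sub_add_cancel hj] at this
    rw [map_sub, cf_X1_pow_mul, if_pos hj, this, sub_self]

/-! ### The Hamburger–Noether substitution -/

/-- Each Euclidean step preserves `p * p' - q * q'`, which is `1` or `-1` at the end of the
algorithm. -/
theorem hnExp_det {p q : ℕ} (h : Nat.Coprime p q) :
    p * (hnExp p q).1 = q * (hnExp p q).2 + 1 ∨ q * (hnExp p q).2 = p * (hnExp p q).1 + 1 := by
  induction hn : p + q using Nat.strong_induction_on generalizing p q with
  | _ n ih =>
    subst hn
    rw [hnExp]
    by_cases hp : p = 0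
    · subst hp
      have : q = 1 := by simpa using h
      simp [this]
    by_cases hq : q = 0
    · subst hq
      have : p = 1 := by simpa using h
      simp [this]
    rw [if_neg hp, if_neg hq]
    split_ifs with hqp
    · have hlt := Nat.mod_lt p (Nat.pos_of_ne_zero hq)
      have hc : Nat.Coprime (p % q) q := by
        rw [Nat.Coprime, ← Nat.gcd_rec, Nat.gcd_comm]; exact h
      have := ih _ (by omega) hc rfl
      have hd := Nat.div_add_mod p q
      set e := hnExp (p % q) q
      have h1 : p * e.1 = q * (p / q) * e.1 + p % q * e.1 := by rw [← add_mul, hd]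
      have h2 : q * (e.2 + p / q * e.1) = q * e.2 + q * (p / q) * e.1 := by ring
      simp only [h1, h2]
      omega
    · have hlt := Nat.mod_lt q (Nat.pos_of_ne_zero hp)
      have hc : Nat.Coprime p (q % p) := by
        rw [Nat.Coprime, Nat.gcd_comm, ← Nat.gcd_rec]; exact h
      have := ih _ (by omega) hc rfl
      have hd := Nat.div_add_mod q p
      set e := hnExp p (q % p)
      have h1 : q * e.2 = p * (q / p) * e.2 + q % p * e.2 := by rw [← add_mul, hd]
      have h2 : p * (e.1 + q / p * e.2) = p * e.1 + p * (q / p) * e.2 := by ring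
      simp only [h1, h2]
      omega

theorem hnRoot_ne_zero {p q : ℕ} {μ : K} (hμ : μ ≠ 0) : hnRoot p q μ ≠ 0 := by
  rw [hnRoot]; split_ifs <;> simp [hμ]

/-- The power series `Y + s` of the Hamburger–Noether substitution. -/
def hnY (p q : ℕ) (μ : K) : Series K := X 1 + C (hnRoot p q μ)

theorem hnY_isUnit {p q : ℕ} {μ : K} (hμ : μ ≠ 0) : IsUnit (hnY p q μ) := by
  rw [isUnit_iff_cf, cf_zero_zero, hnY]
  simpa using hnRoot_ne_zero hμ

theorem hasSubst_hn {p q : ℕ} (hp : 0 < p) (hq : 0 < q) (μ : K) :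
    HasSubst ![(X 0 ^ p * hnY p q μ ^ (hnExp p q).2 : Series K),
      X 0 ^ q * hnY p q μ ^ (hnExp p q).1] := by
  apply hasSubst_of_constantCoeff_zero
  intro i
  fin_cases i <;> simp [hp.ne', hq.ne']

/-- The Hamburger–Noether substitution as an algebra homomorphism. -/
def hnHom {p q : ℕ} (hp : 0 < p) (hq : 0 < q) (μ : K) : Series K →ₐ[K] Series K :=
  substAlgHom (hasSubst_hn hp hq μ)

variable {p q : ℕ} (hp : 0 < p) (hq : 0 < q) (μ : K)

theorem hnHom_apply (f : Series K) : hnHom hp hq μ f = hnTransform p q μ f :=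
  substAlgHom_apply _ f

theorem hnHom_X0 : hnHom hp hq μ (X 0) = X 0 ^ p * hnY p q μ ^ (hnExp p q).2 :=
  substAlgHom_X _ 0

theorem hnHom_X1 : hnHom hp hq μ (X 1) = X 0 ^ q * hnY p q μ ^ (hnExp p q).1 :=
  substAlgHom_X _ 1

theorem algHom_C (σ : Series K →ₐ[K] Series K) (c : K) : σ (C c) = C c := by
  rw [c_eq_algebraMap]; exact σ.commutes c

/-- No continuity of `σ` is available for a termwise expansion. Instead `exists_decomposition` peels
off one `x` or one `y`, which lowers the required order by `p` or `q`. -/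
theorem X0_pow_dvd_algHom {σ : Series K →ₐ[K] Series K} {p q : ℕ} (hp : 0 < p) (hq : 0 < q)
    (h0 : X 0 ^ p ∣ σ (X 0)) (h1 : X 0 ^ q ∣ σ (X 1)) (m : ℕ) (f : Series K)
    (hf : ∀ i j, p * i + q * j < m → cf i j f = 0) : X 0 ^ m ∣ σ f := by
  induction m using Nat.strong_induction_on generalizing f with
  | _ m ih =>
    rcases Nat.eq_zero_or_pos m with rfl | hm
    · simp
    rw [exists_decomposition f, hf 0 0 (by simpa using hm), map_zero, zero_add, map_add, map_mul,
      map_mul]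
    refine dvd_add ?_ ?_
    · have := mul_dvd_mul h0 (ih (m - p) (by omega) (ofCf fun i j => cf (i + 1) j f) ?_)
      · rw [← pow_add] at this
        exact (pow_dvd_pow _ (by omega)).trans this
      · intro i j hij
        rw [cf_ofCf]
        exact hf _ _ (by rw [mul_add]; omega)
    · have := mul_dvd_mul h1 (ih (m - q) (by omega)
        (ofCf fun i j => if i = 0 then cf 0 (j + 1) f else 0) ?_)
      · rw [← pow_add] at this
        exact (pow_dvd_pow _ (by omega)).trans this
      · intro i j hij
        rw [cf_ofCf]
        split_ifs with h
        · subst h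
          exact hf _ _ (by rw [mul_add]; omega)
        · rfl

/-- A derivation along an algebra homomorphism is determined by its values on `x` and `y`. -/
theorem eq_zero_of_leibniz {σ : Series K →ₐ[K] Series K} (h0 : X 0 ∣ σ (X 0)) (h1 : X 0 ∣ σ (X 1))
    (E : Series K →ₗ[K] Series K) (hE : ∀ a b, E (a * b) = σ a * E b + σ b * E a)
    (hE0 : E (X 0) = 0) (hE1 : E (X 1) = 0) (f : Series K) : E f = 0 := by
  have hC : ∀ c, E (C c) = 0 := by
    intro c
    have h := hE 1 1
    rw [mul_one, map_one σ, one_mul, left_eq_add] at h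
    have := E.map_smul c 1
    rwa [h, smul_zero, smul_eq_C_mul, mul_one] at this
  refine eq_zero_of_forall_X0_pow_dvd fun n => ?_
  induction n generalizing f with
  | zero => simp
  | succ n ih =>
    rw [exists_decomposition f, map_add, map_add, hC, zero_add, hE, hE, hE0, hE1, mul_zero,
      mul_zero, add_zero, add_zero, pow_succ']
    exact dvd_add (mul_dvd_mul h0 (ih _)) (mul_dvd_mul h1 (ih _))

/-! ### Euler derivations and reducedness away from the axes -/

/-- The derivation `x * ∂/∂x`. -/
def thetaX : Derivation K (Series K) (Series K) := (X 0 : Series K) • pderiv K 0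

/-- The derivation `y * ∂/∂y`. -/
def thetaY : Derivation K (Series K) (Series K) := (X 1 : Series K) • pderiv K 1

theorem thetaX_apply (f : Series K) : thetaX f = X 0 * pderiv K 0 f := rfl

theorem thetaY_apply (f : Series K) : thetaY f = X 1 * pderiv K 1 f := rfl

theorem cf_thetaX (i j : ℕ) (f : Series K) : cf i j (thetaX f) = i * cf i j f := by
  have h := cf_X0_pow_mul 1 i j (pderiv K 0 f)
  rw [pow_one] at h
  rw [thetaX_apply, h]
  rcases i with _ | i
  · simp
  · rw [if_pos (by omega), cf_apply, coeff_pderiv, cf_apply, Nat.add_sub_cancel]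
    have : expo i j + Finsupp.single 0 1 = expo (i + 1) j := by
      rw [show (Finsupp.single 0 1 : Fin 2 →₀ ℕ) = expo 1 0 by simp [expo], expo_add]; simp
    rw [this, mul_comm]; simp

theorem cf_thetaY (i j : ℕ) (f : Series K) : cf i j (thetaY f) = j * cf i j f := by
  have h := cf_X1_pow_mul 1 i j (pderiv K 1 f)
  rw [pow_one] at h
  rw [thetaY_apply, h]
  rcases j with _ | j
  · simp
  · rw [if_pos (by omega), cf_apply, coeff_pderiv, cf_apply, Nat.add_sub_cancel]
    have : expo i j + Finsupp.single 1 1 = expo i (j + 1) := by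
      rw [show (Finsupp.single 1 1 : Fin 2 →₀ ℕ) = expo 0 1 by simp [expo], expo_add]; simp
    rw [this, mul_comm]; simp

/-- The chain rule for logarithmic derivations. The difference of the two sides is a derivation
along the substitution, so it is enough to treat `x` and `y`, whose images are eigenvectors of `X *
∂/∂X`. -/
theorem thetaX_hnHom (f : Series K) :
    thetaX (hnHom hp hq μ f) = hnHom hp hq μ ((p : K) • thetaX f + (q : K) • thetaY f) := by
  let σ := hnHom hp hq μ
  let D : Derivation K (Series K) (Series K) := (p : K) • thetaX + (q : K) • thetaY
  let E : Series K →ₗ[K] Series K :=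
    thetaX.toLinearMap ∘ₗ σ.toLinearMap - σ.toLinearMap ∘ₗ D.toLinearMap
  have hEa : ∀ a, E a = thetaX (σ a) - σ (D a) := fun a => rfl
  have hY : thetaX (hnY p q μ) = 0 := by
    rw [thetaX_apply, hnY, map_add, pderiv_C, pderiv_X_of_ne (by decide)]; simp
  have hX : thetaX (X 0 : Series K) = X 0 := by rw [thetaX_apply, pderiv_X_self, mul_one]
  have hX1 : thetaX (X 1 : Series K) = 0 := by
    rw [thetaX_apply, pderiv_X_of_ne (by decide), mul_zero]
  have hY0 : thetaY (X 0 : Series K) = 0 := by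
    rw [thetaY_apply, pderiv_X_of_ne (by decide), mul_zero]
  have hY1 : thetaY (X 1 : Series K) = X 1 := by rw [thetaY_apply, pderiv_X_self, mul_one]
  have hpow : ∀ n m : ℕ, thetaX (X 0 ^ n * hnY p q μ ^ m) = (n : K) • (X 0 ^ n * hnY p q μ ^ m) := by
    intro n m
    rw [Derivation.leibniz, Derivation.leibniz_pow, Derivation.leibniz_pow, hY, hX, smul_zero,
      smul_zero, smul_zero, zero_add]
    rcases n with _ | n
    · simp
    · rw [Nat.add_sub_cancel, smul_eq_mul, smul_eq_mul, nsmul_eq_mul, smul_eq_C_mul, map_natCast]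
      ring
  have := eq_zero_of_leibniz (σ := σ) ((dvd_pow_self _ hp.ne').trans (by
      rw [hnHom_X0]; exact Dvd.intro _ rfl)) ((dvd_pow_self _ hq.ne').trans (by
      rw [hnHom_X1]; exact Dvd.intro _ rfl)) E (fun a b => by
      rw [hEa, hEa, hEa, map_mul, Derivation.leibniz, Derivation.leibniz, map_add]
      simp only [smul_eq_mul, map_mul]
      ring) (by
      rw [hEa, hnHom_X0, hpow]
      simp only [D, Derivation.add_apply, Derivation.smul_apply, hX, hY0, smul_zero, add_zero,
        map_smul]
      rw [hnHom_X0, sub_self]) (by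
      rw [hEa, hnHom_X1, hpow]
      simp only [D, Derivation.add_apply, Derivation.smul_apply, hX1, hY1, smul_zero, zero_add,
        map_smul]
      rw [hnHom_X1, sub_self]) f
  rw [hEa, sub_eq_zero] at this
  exact this

/-- The same argument with `(Y + s) * ∂/∂Y`. Together with `thetaX_hnHom` this gives a change of
derivations with matrix rows `(p, q)` and `(q', p')`, of determinant `±1`. -/
theorem pderiv_hnHom (f : Series K) :
    hnY p q μ * pderiv K 1 (hnHom hp hq μ f) =
      hnHom hp hq μ (((hnExp p q).2 : K) • thetaX f + ((hnExp p q).1 : K) • thetaY f) := by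
  let σ := hnHom hp hq μ
  let D : Derivation K (Series K) (Series K) :=
    ((hnExp p q).2 : K) • thetaX + ((hnExp p q).1 : K) • thetaY
  let D' : Derivation K (Series K) (Series K) := hnY p q μ • pderiv K 1
  let E : Series K →ₗ[K] Series K :=
    D'.toLinearMap ∘ₗ σ.toLinearMap - σ.toLinearMap ∘ₗ D.toLinearMap
  have hEa : ∀ a, E a = D' (σ a) - σ (D a) := fun a => rfl
  have hY : D' (hnY p q μ) = hnY p q μ := by
    change hnY p q μ * pderiv K 1 _ = _
    rw [hnY, map_add, pderiv_C, pderiv_X_self]; simp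
  have hD0 : D' (X 0) = 0 := by
    change hnY p q μ * pderiv K 1 _ = _
    rw [pderiv_X_of_ne (by decide), mul_zero]
  have hX : thetaX (X 0 : Series K) = X 0 := by rw [thetaX_apply, pderiv_X_self, mul_one]
  have hX1 : thetaX (X 1 : Series K) = 0 := by
    rw [thetaX_apply, pderiv_X_of_ne (by decide), mul_zero]
  have hY0 : thetaY (X 0 : Series K) = 0 := by
    rw [thetaY_apply, pderiv_X_of_ne (by decide), mul_zero]
  have hY1 : thetaY (X 1 : Series K) = X 1 := by rw [thetaY_apply, pderiv_X_self, mul_one]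
  have hpow : ∀ n m : ℕ, D' (X 0 ^ n * hnY p q μ ^ m) = (m : K) • (X 0 ^ n * hnY p q μ ^ m) := by
    intro n m
    rw [Derivation.leibniz, Derivation.leibniz_pow, Derivation.leibniz_pow, hY, hD0, smul_zero,
      smul_zero, smul_zero, add_zero]
    rcases m with _ | m
    · simp
    · rw [Nat.add_sub_cancel, smul_eq_mul, smul_eq_mul, nsmul_eq_mul, smul_eq_C_mul, map_natCast]
      ring
  have := eq_zero_of_leibniz (σ := σ) ((dvd_pow_self _ hp.ne').trans (by
      rw [hnHom_X0]; exact Dvd.intro _ rfl)) ((dvd_pow_self _ hq.ne').trans (by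
      rw [hnHom_X1]; exact Dvd.intro _ rfl)) E (fun a b => by
      rw [hEa, hEa, hEa, map_mul, Derivation.leibniz, Derivation.leibniz, map_add]
      simp only [smul_eq_mul, map_mul]
      ring) (by
      rw [hEa, hnHom_X0, hpow]
      simp only [D, Derivation.add_apply, Derivation.smul_apply, hX, hY0, smul_zero, add_zero,
        map_smul]
      rw [hnHom_X0, sub_self]) (by
      rw [hEa, hnHom_X1, hpow]
      simp only [D, Derivation.add_apply, Derivation.smul_apply, hX1, hY1, smul_zero, zero_add,
        map_smul]
      rw [hnHom_X1, sub_self]) f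
  rw [hEa, sub_eq_zero] at this
  exact this

/-- A power of `x * y` belongs to the ideal of `f` and its logarithmic derivatives; over a perfect
field this means that `f` is reduced away from the axes. -/
def LogReduced (f : Series K) : Prop :=
  ∃ (m : ℕ) (a b c : Series K), (X 0 * X 1) ^ m = a * f + b * thetaX f + c * thetaY f

/-- A power of `x` belongs to the ideal of `f`, `x * ∂f/∂x` and `∂f/∂y`. -/
def LogReducedX (f : Series K) : Prop :=
  ∃ (m : ℕ) (a b c : Series K), X 0 ^ m = a * f + b * thetaX f + c * pderiv K 1 f

theorem LogReducedX.logReduced {f : Series K} (h : LogReducedX f) : LogReduced f := by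
  obtain ⟨m, a, b, c, h⟩ := h
  refine ⟨m + 1, X 0 * X 1 ^ (m + 1) * a, X 0 * X 1 ^ (m + 1) * b, X 0 * X 1 ^ m * c, ?_⟩
  rw [thetaY_apply]
  linear_combination (X 0 * X 1 ^ (m + 1)) * h

/-- A derivation sends a multiple of `w ^ 2` to a multiple of `w`, so all three generators of the
ideal are divisible by `w`. -/
theorem LogReducedX.dvd_of_sq_dvd {f w : Series K} (h : LogReducedX f) (hw : w ^ 2 ∣ f) :
    ∃ m, w ∣ X 0 ^ m := by
  obtain ⟨m, a, b, c, h⟩ := h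
  obtain ⟨g, rfl⟩ := hw
  have hD : ∀ D : Derivation K (Series K) (Series K), w ∣ D (w ^ 2 * g) := by
    intro D
    rw [Derivation.leibniz, Derivation.leibniz_pow, smul_eq_mul, smul_eq_mul, smul_eq_mul,
      nsmul_eq_mul]
    exact ⟨w * D g + g * (2 * D w), by push_cast; ring⟩
  refine ⟨m, h ▸ dvd_add (dvd_add ?_ ((hD _).mul_left _)) ((hD _).mul_left _)⟩
  exact ⟨a * (w * g), by ring⟩

/-- The image of `x * y` is `X ^ (p + q)` times a unit, so applying the substitution to the given
relation leaves only a power of `X` on the left. -/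
theorem LogReduced.hnTransform {f : Series K} (hf : LogReduced f) (hp : 0 < p) (hq : 0 < q)
    (hpq : Nat.Coprime p q) {μ : K} (hμ : μ ≠ 0) : LogReducedX (hnTransform p q μ f) := by
  obtain ⟨m, a, b, c, h⟩ := hf
  have hX := thetaX_hnHom hp hq μ f
  have hY := pderiv_hnHom hp hq μ f
  have h' := congrArg (hnHom hp hq μ) h
  simp only [map_add, map_mul, map_pow, hnHom_X0, hnHom_X1, smul_eq_C_mul,
    map_natCast] at h' hX hY
  obtain ⟨V, hV⟩ := ((hnY_isUnit (p := p) (q := q) hμ).pow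
    (((hnExp p q).2 + (hnExp p q).1) * m)).exists_right_inv
  rw [← hnHom_apply hp hq]
  set F := hnHom hp hq μ f
  set A := hnHom hp hq μ (thetaX f)
  set B := hnHom hp hq μ (thetaY f)
  set Y := hnY p q μ
  have hdet := hnExp_det hpq
  set p' := (hnExp p q).1
  set q' := (hnExp p q).2
  have key : (X 0 : Series K) ^ ((p + q) * m) =
      V * (X 0 ^ p * Y ^ q' * (X 0 ^ q * Y ^ p')) ^ m := by
    have : (X 0 ^ p * Y ^ q' * (X 0 ^ q * Y ^ p')) ^ m =
        X 0 ^ ((p + q) * m) * Y ^ ((q' + p') * m) := by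
      rw [pow_mul, pow_mul, ← mul_pow]; congr 1; ring
    rw [this]
    linear_combination (-X 0 ^ ((p + q) * m)) * hV
  -- Cramer's rule: the determinant `ε` is `±1`, so nothing has to be inverted in `K`.
  obtain ⟨ε, hε, hA, hB⟩ : ∃ ε : Series K, ε * ε = 1 ∧
      A = ε * (p' * thetaX F - q * (Y * pderiv K 1 F)) ∧
      B = ε * (p * (Y * pderiv K 1 F) - q' * thetaX F) := by
    rw [hX, hY]
    rcases hdet with hd | hd
    · have hd' := congrArg (fun n : ℕ => (n : Series K)) hd
      push_cast at hd'
      exact ⟨1, by ring, by linear_combination (-A) * hd', by linear_combination (-B) * hd'⟩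
    · have hd' := congrArg (fun n : ℕ => (n : Series K)) hd
      push_cast at hd'
      exact ⟨-1, by ring, by linear_combination (-A) * hd', by linear_combination (-B) * hd'⟩
  refine ⟨(p + q) * m, V * hnHom hp hq μ a,
    V * ε * (hnHom hp hq μ b * p' - hnHom hp hq μ c * q'),
    V * ε * Y * (hnHom hp hq μ c * p - hnHom hp hq μ b * q), ?_⟩
  rw [key, h', hA, hB]
  ring

-- The exponents `q * q'` and `p * p'` differ by one, so a unit times an expression of degree one in
-- `Y + s` remains. It vanishes at `Y = 0` only for `μ' = μ`, and then simply, whatever the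
-- characteristic.
open Classical in
theorem hnHom_factor_eq {p q : ℕ} (hpq : Nat.Coprime p q) {μ μ' : K} (hμ : μ ≠ 0) :
    ∃ U : Series K, IsUnit U ∧ hnY p q μ ^ (q * (hnExp p q).2) -
      C μ' * hnY p q μ ^ (p * (hnExp p q).1) = (if μ' = μ then X 1 else 1) * U := by
  have hY := hnY_isUnit (p := p) (q := q) hμ
  have hs : hnY p q μ = X 1 + C (hnRoot p q μ) := rfl
  have hdet := hnExp_det hpq
  rw [hnRoot] at hs
  set p' := (hnExp p q).1
  set q' := (hnExp p q).2
  set Y := hnY p q μ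
  rcases hdet with h | h
  · rw [if_pos (by omega)] at hs
    rw [h, pow_succ]
    split_ifs with he
    · subst he
      refine ⟨Y ^ (q * q') * (-C μ'), (hY.pow _).mul ?_, ?_⟩
      · rw [isUnit_iff_cf, cf_zero_zero]; simpa using hμ
      · have : (C μ' * C μ'⁻¹ : Series K) = 1 := by rw [← map_mul, mul_inv_cancel₀ hμ, map_one]
        linear_combination (-(C μ') * Y ^ (q * q')) * hs - Y ^ (q * q') * this
    · refine ⟨Y ^ (q * q') * (1 - C μ' * Y), (hY.pow _).mul ?_, by ring⟩
      rw [isUnit_iff_cf, cf_zero_zero, hs]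
      simp only [map_sub, map_one, map_mul, constantCoeff_C, map_add, constantCoeff_X, zero_add]
      intro h0
      apply he
      field_simp at h0
      linear_combination -h0
  · rw [if_neg (by omega)] at hs
    rw [h, pow_succ]
    split_ifs with he
    · subst he
      exact ⟨Y ^ (p * p'), hY.pow _, by linear_combination (Y ^ (p * p')) * hs⟩
    · refine ⟨Y ^ (p * p') * (Y - C μ'), (hY.pow _).mul ?_, by ring⟩
      rw [isUnit_iff_cf, cf_zero_zero, hs]
      simp only [map_sub, constantCoeff_C, map_add, constantCoeff_X, zero_add]
      intro h0
      exact he (by linear_combination -h0)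

/-! ### Square-free power series are reduced away from the axes -/

theorem HasForm.pow {f : Series K} {N e : ℕ} (hf : HasForm f N e) (n : ℕ) :
    HasForm (f ^ n) (n * N) (n * e) := by
  induction n with
  | zero => simpa using IsUnit.hasForm isUnit_one
  | succ n ih => rw [pow_succ, add_one_mul, add_one_mul]; exact ih.mul hf

theorem hasForm_X1 : HasForm (X 1 : Series K) 0 1 := ⟨1, 0, isUnit_one, by simp⟩

theorem cf_pow_char (p : ℕ) [hp : Fact p.Prime] [CharP K p] (v : Series K) (i j : ℕ) :
    cf i j (v ^ p) = if p ∣ i ∧ p ∣ j then cf (i / p) (j / p) v ^ p else 0 := by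
  rw [← map_frobenius_expand p hp.out.ne_zero, cf_apply, coeff_map]
  split_ifs with h
  · have : expo i j = p • expo (i / p) (j / p) := by
      ext k; fin_cases k <;> simp [Nat.mul_div_cancel' h.1, Nat.mul_div_cancel' h.2]
    rw [this, coeff_expand_smul, frobenius_def, cf_apply]
  · rw [not_and_or] at h
    rcases h with h | h
    · rw [coeff_expand_of_not_dvd p hp.out.ne_zero v (i := 0) (by simpa using h), map_zero]
    · rw [coeff_expand_of_not_dvd p hp.out.ne_zero v (i := 1) (by simpa using h), map_zero]

theorem exists_pow_char_eq [IsAlgClosed K] (p : ℕ) [hp : Fact p.Prime] [CharP K p] (w : Series K)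
    (hw : ∀ i j, cf i j w ≠ 0 → p ∣ i ∧ p ∣ j) : ∃ v, v ^ p = w := by
  choose r hr using fun x : K => IsAlgClosed.exists_pow_nat_eq x hp.out.pos
  refine ⟨ofCf fun i j => r (cf (p * i) (p * j) w), series_ext fun i j => ?_⟩
  rw [cf_pow_char]
  split_ifs with h
  · rw [cf_ofCf, hr, Nat.mul_div_cancel' h.1, Nat.mul_div_cancel' h.2]
  · by_contra h'
    exact h (hw i j (Ne.symm h'))

section

variable {P : Ideal (Series K)} {e : ℕ}

theorem exists_mem_hasForm_zero [hP : P.IsPrime] (hx : X 0 ∉ P) {r : Series K} (hr : r ∈ P) {m d : ℕ}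
    (h : HasForm r m d) : ∃ r' ∈ P, HasForm r' 0 d := by
  obtain ⟨U, G, hU, rfl⟩ := h
  exact ⟨X 1 ^ d * U + X 0 * G, (hP.mem_or_mem hr).resolve_left fun h => hx (hP.mem_of_pow_mem _ h),
    U, G, hU, by simp⟩

/-- Powers of `x` can be cancelled in `P`; a nonzero `r` of degree less than `e` would then give an
element of `P` whose restriction to `x = 0` has order below the minimum. -/
theorem eq_zero_of_mem_of_degree_lt [hP : P.IsPrime] (hx : X 0 ∉ P)
    (hmin : ∀ w ∈ P, ∀ d, HasForm w 0 d → e ≤ d) {r : Series K} (hr : r ∈ P)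
    (hdeg : ∀ i j, e ≤ j → cf i j r = 0) : r = 0 := by
  by_contra h0
  obtain ⟨m, d, h⟩ := exists_hasForm h0
  obtain ⟨r', hr', h'⟩ := exists_mem_hasForm_zero hx hr h
  exact (hasForm_iff.mp h).2.2 (hdeg m d (hmin r' hr' d h'))

/-- A prime ideal not containing `x` contains a Weierstrass polynomial of the minimal degree. -/
theorem exists_weierstrass_mem (hmin : ∀ w ∈ P, ∀ d, HasForm w 0 d → e ≤ d)
    (hex : ∃ w ∈ P, HasForm w 0 e) :
    ∃ w ∈ P, HasForm w 0 e ∧ ∀ i j, e ≤ j → cf i j w = if i = 0 ∧ j = e then 1 else 0 := by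
  obtain ⟨w, hw, hwe⟩ := hex
  obtain ⟨a, s, h, hs⟩ := exists_weierstrass_division hwe (X 1 ^ e)
  have hdeg : ∀ i j, e ≤ j → cf i j (w * a) = if i = 0 ∧ j = e then 1 else 0 := by
    intro i j hj
    have h1 := cf_X1_pow_mul e i j (1 : Series K)
    have h2 := cf_C (K := K) i (j - e) 1
    rw [map_one C] at h2
    rw [mul_one, h, map_add, hs i j hj, add_zero, if_pos hj, h2] at h1
    rw [h1]
    congr 1
    rw [eq_iff_iff]
    omega
  have hne : cf 0 e (w * a) ≠ 0 := by rw [hdeg 0 e le_rfl]; simp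
  refine ⟨w * a, P.mul_mem_right _ hw, ?_, hdeg⟩
  have h0 : w * a ≠ 0 := fun h => hne (by rw [h, map_zero])
  obtain ⟨m, d, hmd⟩ := exists_hasForm h0
  have h1 := hasForm_iff.mp hmd
  obtain rfl : m = 0 := by
    by_contra hm
    exact hne (h1.1 0 e (Nat.pos_of_ne_zero hm))
  have : d ≤ e := by
    by_contra hd
    exact hne (h1.2.1 e (by omega))
  rwa [le_antisymm this (hmin _ (P.mul_mem_right _ hw) d hmd)] at hmd

end

/-- Otherwise some prime `P` contains `f` and its logarithmic derivatives but not `x * y`. A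
Weierstrass polynomial `w` of minimal degree `e` generates `P`, and `f = w * u` with `u ∉ P` by
square-freeness, so the derivatives of `w` lie in `P`. Comparing degrees gives `x ∂w/∂x = 0` and `y
∂w/∂y = e w`. If `e ≠ 0` in `K`, every monomial of `w` involves `y`, so `y` divides `w`; if `e = 0`
in `K`, then `w` is a `p`-th power, `p` being the characteristic. Both contradict the minimality of
`e`. -/
theorem logReduced_of_squarefree [IsAlgClosed K] {f : Series K} (hf : Squarefree f) :
    LogReduced f := by
  by_contra hcon
  obtain ⟨P, hP, hIP, hdis⟩ := Ideal.exists_le_prime_disjoint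
    (Ideal.span {f, thetaX f, thetaY f}) (Submonoid.powers (X 0 * X 1 : Series K)) (by
      rw [Set.disjoint_left]
      rintro z hz ⟨m, rfl⟩
      obtain ⟨a, b, c, h⟩ := Submodule.mem_span_triple.mp hz
      exact hcon ⟨m, a, b, c, h.symm⟩)
  have hxy : (X 0 * X 1 : Series K) ∉ P :=
    fun h => Set.disjoint_left.mp hdis h (Submonoid.mem_powers _)
  have hx : (X 0 : Series K) ∉ P := fun h => hxy (P.mul_mem_right _ h)
  have hy : (X 1 : Series K) ∉ P := fun h => hxy (P.mul_mem_left _ h)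
  have hfP : f ∈ P := hIP (Ideal.subset_span (by simp))
  have hfX : thetaX f ∈ P := hIP (Ideal.subset_span (by simp))
  have hfY : thetaY f ∈ P := hIP (Ideal.subset_span (by simp))
  obtain ⟨N, d, hNd⟩ := exists_hasForm hf.ne_zero
  have hex : ∃ e, ∃ w ∈ P, HasForm w 0 e := ⟨d, exists_mem_hasForm_zero hx hfP hNd⟩
  classical
  obtain ⟨e, he, hmin'⟩ : ∃ e, (∃ w ∈ P, HasForm w 0 e) ∧ ∀ w ∈ P, ∀ d, HasForm w 0 d → e ≤ d :=
    ⟨Nat.find hex, Nat.find_spec hex, fun w hw d hd => Nat.find_min' hex ⟨w, hw, hd⟩⟩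
  obtain ⟨w, hw, hwe, hdeg⟩ := exists_weierstrass_mem hmin' he
  have he0 : 0 < e := by
    rcases Nat.eq_zero_or_pos e with rfl | h
    · exact absurd (P.eq_top_of_isUnit_mem hw hwe.isUnit) hP.ne_top
    · exact h
  have hgen : ∀ h ∈ P, w ∣ h := by
    intro h hh
    obtain ⟨a, r, rfl, hr⟩ := exists_weierstrass_division hwe h
    rw [eq_zero_of_mem_of_degree_lt hx hmin' ((P.add_mem_iff_right (P.mul_mem_right _ hw)).mp hh) hr,
      add_zero]
    exact Dvd.intro _ rfl
  obtain ⟨u, rfl⟩ := hgen f hfP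
  have hu : u ∉ P := by
    intro hu
    obtain ⟨v, rfl⟩ := hgen u hu
    exact hP.ne_top (P.eq_top_of_isUnit_mem hw (hf w ⟨v, by ring⟩))
  have hD : ∀ D : Derivation K (Series K) (Series K), D (w * u) ∈ P → D w ∈ P := by
    intro D h
    rw [Derivation.leibniz, smul_eq_mul, smul_eq_mul,
      P.add_mem_iff_right (P.mul_mem_right _ hw)] at h
    exact (hP.mem_or_mem h).resolve_left hu
  have hX0 : thetaX w = 0 := by
    refine eq_zero_of_mem_of_degree_lt hx hmin' (hD _ hfX) fun i j hj => ?_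
    rw [cf_thetaX, hdeg i j hj]
    split_ifs with h
    · simp [h.1]
    · simp
  -- Subtracting `e * w` cancels the leading term `e * y ^ e`.
  have hY0 : thetaY w - C (e : K) * w = 0 := by
    refine eq_zero_of_mem_of_degree_lt hx hmin' (P.sub_mem (hD _ hfY) (P.mul_mem_left _ hw))
      fun i j hj => ?_
    rw [map_sub, cf_thetaY, cf_C_mul, hdeg i j hj]
    split_ifs with h
    · simp [h.2]
    · simp
  have hi : ∀ i j, cf i j w ≠ 0 → (i : K) = 0 := by
    intro i j h
    have := congrArg (cf i j) hX0
    rw [cf_thetaX, map_zero] at this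
    exact (mul_eq_zero.mp this).resolve_right h
  have hj : ∀ i j, cf i j w ≠ 0 → (j : K) = (e : K) := by
    intro i j h
    have := congrArg (cf i j) hY0
    rw [map_sub, cf_thetaY, cf_C_mul, map_zero, ← sub_mul] at this
    exact sub_eq_zero.mp ((mul_eq_zero.mp this).resolve_right h)
  by_cases hek : (e : K) = 0
  · obtain ⟨p, hp⟩ := CharP.exists K
    have hpe : p ∣ e := (CharP.cast_eq_zero_iff K p e).mp hek
    have hp0 : p ≠ 0 := by
      rintro rfl
      exact he0.ne' (Nat.eq_zero_of_zero_dvd hpe)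
    have hpp : p.Prime := (CharP.char_is_prime_or_zero K p).resolve_right hp0
    have : Fact p.Prime := ⟨hpp⟩
    obtain ⟨v, rfl⟩ := exists_pow_char_eq p w fun i j h =>
      ⟨(CharP.cast_eq_zero_iff K p i).mp (hi i j h),
        (CharP.cast_eq_zero_iff K p j).mp ((hj i j h).trans hek)⟩
    have hv0 : v ≠ 0 := by
      rintro rfl
      exact hwe.ne_zero (zero_pow hp0)
    obtain ⟨m, d, hv⟩ := exists_hasForm hv0
    obtain ⟨h1, h2⟩ := hwe.unique (hv.pow p)
    obtain ⟨v', hv', h'⟩ := exists_mem_hasForm_zero hx (hP.mem_of_pow_mem _ hw) hv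
    have h3 := hmin' v' hv' d h'
    have h4 := hpp.two_le
    nlinarith
  · obtain ⟨w', rfl⟩ : X 1 ∣ w := by
      rw [← pow_one (X 1 : Series K), X1_pow_dvd_iff]
      intro i j h1
      by_contra h
      have := hj i j h
      rw [Nat.lt_one_iff.mp h1, Nat.cast_zero] at this
      exact hek this.symm
    have h1 := hasForm_X1.of_mul_left hwe
    have h2 := hmin' w' ((hP.mem_or_mem hw).resolve_left hy) _ h1.2.2
    omega

/-! ### Face polynomials -/

/-- The face of `S` in the direction `p X + q Y` is the segment from `(a, b + p r)` to
`(a + q r, b)`. -/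
structure IsFace (S : Set (ℕ × ℕ)) (p q a b r : ℕ) : Prop where
  top_mem : (a, b + p * r) ∈ S
  bot_mem : (a + q * r, b) ∈ S
  le : ∀ z ∈ S, p * a + q * (b + p * r) ≤ p * z.1 + q * z.2
  mem_Icc : ∀ z ∈ S, p * z.1 + q * z.2 = p * a + q * (b + p * r) → a ≤ z.1 ∧ z.1 ≤ a + q * r

theorem IsFace.unique {S : Set (ℕ × ℕ)} {p q a b r a' b' r' : ℕ} (hq : 0 < q)
    (h : IsFace S p q a b r) (h' : IsFace S p q a' b' r') : a = a' ∧ b = b' ∧ r = r' := by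
  have e : p * a + q * (b + p * r) = p * a' + q * (b' + p * r') :=
    le_antisymm (h.le _ h'.top_mem) (h'.le _ h.top_mem)
  have e1 : ∀ a b r, p * (a + q * r) + q * b = p * a + q * (b + p * r) := by intros; ring
  have h1 := h.mem_Icc _ h'.top_mem e.symm
  have h2 := h'.mem_Icc _ h.top_mem e
  have h3 := h.mem_Icc _ h'.bot_mem ((e1 _ _ _).trans e.symm)
  have h4 := h'.mem_Icc _ h.bot_mem ((e1 _ _ _).trans e)
  obtain rfl : a = a' := by simp only at h1 h2; omega
  have : q * r = q * r' := by simp only at h3 h4; omega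
  obtain rfl := Nat.eq_of_mul_eq_mul_left hq this
  refine ⟨rfl, ?_, rfl⟩
  have := Nat.eq_of_mul_eq_mul_left hq (Nat.add_left_cancel e)
  omega

theorem cf_faceForm (p q i j : ℕ) (f : Series K) :
    cf i j (faceForm p q f) = if p * i + q * j = weight p q f then cf i j f else 0 := by
  rw [cf_apply, coeff_apply, faceForm, expo_zero, expo_one]; rfl

theorem weight_le {f : Series K} (p q : ℕ) {z : ℕ × ℕ} (hz : z ∈ supp f) :
    weight p q f ≤ p * z.1 + q * z.2 :=
  Nat.sInf_le ⟨z, hz, rfl⟩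

theorem exists_weight_eq {f : Series K} (hf : f ≠ 0) (p q : ℕ) :
    ∃ z ∈ supp f, p * z.1 + q * z.2 = weight p q f := by
  obtain ⟨z, hz⟩ := supp_nonempty hf
  obtain ⟨w, hw, h⟩ := Nat.sInf_mem (s := {N | ∃ z ∈ supp f, N = p * z.1 + q * z.2}) ⟨_, z, hz, rfl⟩
  exact ⟨w, hw, h.symm⟩

theorem homogenize_linear_pow (m : K) (n : ℕ) :
    ((Polynomial.X - Polynomial.C m) ^ n).homogenize n =
      (MvPolynomial.X 0 - MvPolynomial.C m * MvPolynomial.X 1) ^ n := by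
  induction n with
  | zero => simp
  | succ n ih =>
    rw [pow_succ, Polynomial.homogenize_mul _ _ ?_ ?_, ih, Polynomial.homogenize_sub,
      Polynomial.homogenize_X one_ne_zero, Polynomial.homogenize_C, pow_succ _ n]
    · simp [pow_succ]
    · exact (Polynomial.natDegree_pow_le_of_le n (Polynomial.natDegree_X_sub_C_le m)).trans (by simp)
    · exact Polynomial.natDegree_X_sub_C_le m

/-- The monic polynomial with roots `μ j` of multiplicity `ν j`. -/
def rootPoly {n : ℕ} (μ : Fin n → K) (ν : Fin n → ℕ) : Polynomial K :=
  ∏ j, (Polynomial.X - Polynomial.C (μ j)) ^ ν j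

theorem rootPoly_monic {n : ℕ} (μ : Fin n → K) (ν : Fin n → ℕ) : (rootPoly μ ν).Monic :=
  Polynomial.monic_prod_of_monic _ _ fun _ _ => (Polynomial.monic_X_sub_C _).pow _

theorem rootPoly_natDegree {n : ℕ} (μ : Fin n → K) (ν : Fin n → ℕ) :
    (rootPoly μ ν).natDegree = ∑ j, ν j := by
  rw [rootPoly, Polynomial.natDegree_prod_of_monic _ _ fun _ _ => (Polynomial.monic_X_sub_C _).pow _]
  simp

theorem rootPoly_coeff_zero {n : ℕ} {μ : Fin n → K} (hμ : ∀ j, μ j ≠ 0) (ν : Fin n → ℕ) :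
    (rootPoly μ ν).coeff 0 ≠ 0 := by
  rw [Polynomial.coeff_zero_eq_eval_zero, rootPoly, Polynomial.eval_prod, Finset.prod_ne_zero_iff]
  intro j _
  simpa using fun h => absurd h (hμ j)

/-- Homogenize the one-variable polynomial `rootPoly` and substitute `x ^ q` and `y ^ p` for the two
variables. -/
theorem prod_face_eq {n : ℕ} (p q : ℕ) (μ : Fin n → K) (ν : Fin n → ℕ) :
    (∏ j, (X 0 ^ q - C (μ j) * X 1 ^ p) ^ ν j : Series K) =
      ∑ k ∈ Finset.range (∑ j, ν j + 1),
        C ((rootPoly μ ν).coeff k) * X 0 ^ (q * k) * X 1 ^ (p * (∑ j, ν j - k)) := by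
  have h := Polynomial.homogenize_finsetProd (s := Finset.univ)
    (p := fun j => (Polynomial.X - Polynomial.C (μ j)) ^ ν j) (n := ν) fun j _ =>
      (Polynomial.natDegree_pow_le_of_le (ν j) (Polynomial.natDegree_X_sub_C_le (μ j))).trans
        (by simp)
  simp only [homogenize_linear_pow] at h
  have h' := congrArg (MvPolynomial.aeval ![(X 0 ^ q : Series K), X 1 ^ p]) h
  rw [map_prod] at h'
  simp only [map_pow, map_sub, map_mul, MvPolynomial.aeval_X, MvPolynomial.aeval_C,
    Matrix.cons_val_zero, Matrix.cons_val_one, ← c_eq_algebraMap] at h'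
  rw [← h', Polynomial.homogenize, map_sum, Finset.Nat.sum_antidiagonal_eq_sum_range_succ_mk]
  refine Finset.sum_congr rfl fun k _ => ?_
  rw [MvPolynomial.aeval_monomial, ← c_eq_algebraMap, Finsupp.prod_fintype _ _ (by simp)]
  simp [Fin.prod_univ_two, pow_mul, mul_assoc, rootPoly]

theorem cf_monomial_mul (c d : K) (a b a' b' i j : ℕ) :
    cf i j (C c * X 0 ^ a * X 1 ^ b * (C d * X 0 ^ a' * X 1 ^ b') : Series K) =
      if i = a + a' ∧ j = b + b' then c * d else 0 := by
  classical
  rw [← monomial_expo, ← monomial_expo, monomial_mul_monomial, cf_apply, coeff_monomial, expo_add]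
  simp only [expo_inj]

theorem cf_face {n : ℕ} (p q : ℕ) (c : K) (a b : ℕ) (μ : Fin n → K) (ν : Fin n → ℕ) (i j : ℕ) :
    cf i j (C c * X 0 ^ a * X 1 ^ b * ∏ j, (X 0 ^ q - C (μ j) * X 1 ^ p) ^ ν j : Series K) =
      ∑ k ∈ Finset.range (∑ j, ν j + 1),
        if i = a + q * k ∧ j = b + p * (∑ j, ν j - k) then c * (rootPoly μ ν).coeff k else 0 := by
  rw [prod_face_eq, Finset.mul_sum, map_sum]
  simp only [cf_monomial_mul]

/-- The two ends of the face come from the extreme coefficients of `rootPoly`: the leading one is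
`1`, and the constant one is nonzero because no root is zero. -/
theorem IsFaceFactorization.isFace {p q : ℕ} (hq : 0 < q) {f : Series K} {n : ℕ}
    {μ : Fin n → K} {ν : Fin n → ℕ} {c : K} {a b : ℕ} (hμ : ∀ j, μ j ≠ 0) (hc : c ≠ 0)
    (h : faceForm p q f = C c * X 0 ^ a * X 1 ^ b * ∏ j, (X 0 ^ q - C (μ j) * X 1 ^ p) ^ ν j) :
    IsFace (supp f) p q a b (∑ j, ν j) ∧ weight p q f = p * a + q * (b + p * ∑ j, ν j) := by
  have hcf := fun i j => cf_face p q c a b μ ν i j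
  simp only [← h, cf_faceForm] at hcf
  set r := ∑ j, ν j with hr
  have h1 := hcf a (b + p * r)
  rw [Finset.sum_eq_single_of_mem 0 (by simp) (fun k _ hk => if_neg fun h => by
    have := Nat.mul_pos hq (Nat.pos_of_ne_zero hk); omega)] at h1
  have h2 := hcf (a + q * r) b
  rw [Finset.sum_eq_single_of_mem r (by simp) (fun k _ hk => if_neg fun h =>
    hk (Nat.eq_of_mul_eq_mul_left hq (Nat.add_left_cancel h.1)).symm)] at h2
  rw [if_pos (⟨by simp, by simp⟩ : a = a + q * 0 ∧ b + p * r = b + p * (r - 0))] at h1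
  rw [if_pos (⟨rfl, by simp⟩ : a + q * r = a + q * r ∧ b = b + p * (r - r))] at h2
  have hr1 : (rootPoly μ ν).coeff r = 1 := by
    rw [hr, ← rootPoly_natDegree μ ν]; exact rootPoly_monic μ ν
  rw [hr1, mul_one] at h2
  have h1' : c * (rootPoly μ ν).coeff 0 ≠ 0 := mul_ne_zero hc (rootPoly_coeff_zero hμ ν)
  have hw1 : p * a + q * (b + p * r) = weight p q f := by
    by_contra h'
    rw [if_neg h'] at h1
    exact h1' h1.symm
  have hw2 : p * (a + q * r) + q * b = weight p q f := by rw [← hw1]; ring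
  rw [if_pos hw1] at h1
  rw [if_pos hw2] at h2
  refine ⟨⟨?_, ?_, fun z hz => hw1 ▸ weight_le p q hz, fun z hz hzw => ?_⟩, hw1.symm⟩
  · rw [mem_supp, h1]; exact h1'
  · rw [mem_supp, h2]; exact hc
  · have h3 := hcf z.1 z.2
    rw [if_pos (hzw.trans hw1)] at h3
    obtain ⟨k, hk, hk'⟩ := Finset.exists_ne_zero_of_sum_ne_zero (by rw [← h3]; exact hz)
    rw [ne_eq, ite_eq_right_iff, Classical.not_imp] at hk'
    rw [hk'.1.1]
    exact ⟨Nat.le_add_right _ _, Nat.add_le_add_left (Nat.mul_le_mul_left _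
      (Nat.lt_succ_iff.mp (Finset.mem_range.mp hk))) _⟩

theorem exists_isFaceFactorization [IsAlgClosed K] {f : Series K} (hf : f ≠ 0) {p q : ℕ}
    (hp : 0 < p) (hq : 0 < q) (hpq : Nat.Coprime p q) :
    ∃ (n : ℕ) (μ : Fin n → K) (ν : Fin n → ℕ), IsFaceFactorization p q f μ ν := by
  classical
  have hex : ∃ a B, (a, B) ∈ supp f ∧ p * a + q * B = weight p q f := by
    obtain ⟨z, hz, h⟩ := exists_weight_eq hf p q
    exact ⟨z.1, z.2, hz, h⟩
  obtain ⟨a, ⟨B, hB, hBw⟩, ha⟩ : ∃ a, (∃ B, (a, B) ∈ supp f ∧ p * a + q * B = weight p q f) ∧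
      ∀ i j, (i, j) ∈ supp f → p * i + q * j = weight p q f → a ≤ i :=
    ⟨Nat.find hex, Nat.find_spec hex, fun i j h h' => Nat.find_min' hex ⟨j, h, h'⟩⟩
  -- Coprimality spaces the lattice points of the supporting line by `(q, -p)`, so the face is
  -- governed by a polynomial in one variable.
  have hline : ∀ i j, (i, j) ∈ supp f → p * i + q * j = weight p q f →
      ∃ k, i = a + q * k ∧ j + p * k = B := by
    intro i j hij hw
    have hai := ha i j hij hw
    obtain ⟨t, rfl⟩ := Nat.exists_eq_add_of_le hai
    have h1 : p * t + q * j = q * B := by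
      rw [mul_add] at hw; omega
    have h2 : q ∣ p * t := (Nat.dvd_add_left (Dvd.intro _ rfl)).mp (h1 ▸ Dvd.intro _ rfl)
    obtain ⟨k, rfl⟩ := hpq.symm.dvd_of_dvd_mul_left h2
    refine ⟨k, rfl, Nat.eq_of_mul_eq_mul_left hq ?_⟩
    rw [← h1]; ring
  let Q : ℕ → Prop := fun k => p * k ≤ B ∧ (a + q * k, B - p * k) ∈ supp f
  have hQ0 : Q 0 := ⟨by simp, by simpa using hB⟩
  let r := Nat.findGreatest Q B
  have hQr : Q r := Nat.findGreatest_spec (Nat.zero_le _) hQ0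
  have hle : ∀ k, Q k → k ≤ r := fun k hk =>
    Nat.le_findGreatest ((Nat.le_mul_of_pos_left k hp).trans hk.1) hk
  obtain ⟨b, hb⟩ := Nat.exists_eq_add_of_le hQr.1
  let P : Polynomial K := ∑ k ∈ Finset.range (r + 1),
    Polynomial.monomial k (cf (a + q * k) (b + p * (r - k)) f)
  have hcoeff : ∀ k, P.coeff k = if k ≤ r then cf (a + q * k) (b + p * (r - k)) f else 0 := by
    intro k
    simp only [P, Polynomial.finsetSum_coeff, Polynomial.coeff_monomial, Finset.sum_ite_eq',
      Finset.mem_range, Nat.lt_succ_iff]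
  have hPr : P.coeff r ≠ 0 := by
    rw [hcoeff, if_pos le_rfl, Nat.sub_self, mul_zero, add_zero]
    have := hQr.2
    rwa [hb, Nat.add_sub_cancel_left] at this
  have hP0 : P.coeff 0 ≠ 0 := by
    rw [hcoeff, if_pos (Nat.zero_le _), mul_zero, add_zero, Nat.sub_zero, add_comm b, ← hb]
    exact hB
  have hdeg : P.natDegree = r :=
    le_antisymm (Polynomial.natDegree_le_iff_coeff_eq_zero.mpr fun k hk => by
      rw [hcoeff, if_neg (by omega)]) (Polynomial.le_natDegree_of_ne_zero hPr)
  have hPne : P ≠ 0 := fun h => hPr (by rw [h, Polynomial.coeff_zero])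
  let E := P.roots.toFinset.equivFin.symm
  let μ : Fin P.roots.toFinset.card → K := fun j => E j
  let ν : Fin P.roots.toFinset.card → ℕ := fun j => P.roots.count (E j : K)
  have hprod : P = Polynomial.C P.leadingCoeff * rootPoly μ ν := by
    conv_lhs => rw [(IsAlgClosed.splits P).eq_prod_roots]
    rw [Finset.prod_multiset_map_count, ← Finset.prod_coe_sort]
    congr 1
    exact (Equiv.prod_comp E (fun m : P.roots.toFinset =>
      (Polynomial.X - Polynomial.C (m : K)) ^ P.roots.count (m : K))).symm
  have hlead : P.leadingCoeff ≠ 0 := Polynomial.leadingCoeff_ne_zero.mpr hPne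
  have hsum : ∑ j, ν j = r := by
    rw [← rootPoly_natDegree μ ν, ← hdeg]
    conv_rhs => rw [hprod, Polynomial.natDegree_C_mul hlead]
  refine ⟨_, μ, ν, fun i j h => E.injective (Subtype.ext h), fun j h => ?_, fun j => ?_,
    P.leadingCoeff, a, b, hlead, series_ext fun i j => ?_⟩
  · have hm := Multiset.mem_toFinset.mp (E j).2
    rw [Polynomial.mem_roots hPne, Polynomial.IsRoot, show ((E j : K)) = 0 from h,
      ← Polynomial.coeff_zero_eq_eval_zero] at hm
    exact hP0 hm
  · exact Multiset.count_pos.mpr (Multiset.mem_toFinset.mp (E j).2)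
  · rw [cf_face, cf_faceForm, hsum]
    have hc : ∀ k, P.leadingCoeff * (rootPoly μ ν).coeff k = P.coeff k := fun k => by
      conv_rhs => rw [hprod, Polynomial.coeff_C_mul]
    simp only [hc]
    by_cases h : ∃ k ≤ r, i = a + q * k ∧ j = b + p * (r - k)
    · obtain ⟨k, hk, rfl, rfl⟩ := h
      have hw : p * (a + q * k) + q * (b + p * (r - k)) = weight p q f := by
        rw [← hBw, hb]
        obtain ⟨t, ht⟩ := Nat.exists_eq_add_of_le hk
        rw [ht, Nat.add_sub_cancel_left]
        ring
      rw [if_pos hw, Finset.sum_eq_single_of_mem k (by simpa [Nat.lt_succ_iff] using hk)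
        (fun k' _ hk' =>
          if_neg fun h => hk' (Nat.eq_of_mul_eq_mul_left hq (Nat.add_left_cancel h.1)).symm),
        if_pos ⟨rfl, rfl⟩, hcoeff, if_pos hk]
    · rw [Finset.sum_eq_zero fun k hk => if_neg fun h' =>
        h ⟨k, Nat.lt_succ_iff.mp (Finset.mem_range.mp hk), h'⟩]
      split_ifs with hw
      · by_contra hne
        obtain ⟨k, rfl, hk⟩ := hline i j hne hw
        have hkr := hle k ⟨by omega, by rwa [← hk, Nat.add_sub_cancel]⟩
        refine h ⟨k, hkr, rfl, ?_⟩
        obtain ⟨t, ht⟩ := Nat.exists_eq_add_of_le hkr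
        rw [ht, Nat.add_sub_cancel_left]
        rw [← hk, ht, mul_add] at hb
        omega
      · rfl

/-! ### The strict transform -/

-- Terms off the face have weight at least `N + 1`, where `N` is the weight of the face, and go to
-- multiples of `X ^ (N + 1)`. On the face, only the factor whose root is `m` contributes a power of
-- `Y`, by `hnHom_factor_eq`.
open Classical in
theorem IsFaceFactorization.hasForm_hnTransform {p q : ℕ} (hp : 0 < p) (hq : 0 < q)
    (hpq : Nat.Coprime p q) {f : Series K} {n : ℕ} {μ : Fin n → K} {ν : Fin n → ℕ}
    (h : IsFaceFactorization p q f μ ν) {m : K} (hm : m ≠ 0) :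
    HasForm (hnTransform p q m f) (weight p q f) (∑ j, if μ j = m then ν j else 0) := by
  obtain ⟨-, hμ, -, c, a, b, hc, hfac⟩ := h
  have hw := (IsFaceFactorization.isFace hq hμ hc hfac).2
  rw [← hnHom_apply hp hq]
  set σ := hnHom hp hq m
  obtain ⟨R, hR⟩ := X0_pow_dvd_algHom (σ := σ) hp hq (by rw [hnHom_X0]; exact Dvd.intro _ rfl)
    (by rw [hnHom_X1]; exact Dvd.intro _ rfl) (weight p q f + 1) (f - faceForm p q f) (by
      intro i j hij
      rw [map_sub, cf_faceForm]
      split_ifs with h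
      · rw [sub_self]
      · rw [sub_zero]
        by_contra hne
        have := weight_le p q (z := (i, j)) hne
        simp only at this
        omega)
  choose U hU hfact using fun j => hnHom_factor_eq (p := p) (q := q) hpq (μ' := μ j) hm
  have hY := hnY_isUnit (p := p) (q := q) hm
  set Y := hnY p q m
  obtain ⟨V, hV, h1⟩ : ∃ V, IsUnit V ∧ σ (faceForm p q f) =
      X 0 ^ weight p q f * (X 1 ^ (∑ j, if μ j = m then ν j else 0) * V) := by
    refine ⟨C c * (Y ^ ((hnExp p q).2 * a) * Y ^ ((hnExp p q).1 * b)) * ∏ j, U j ^ ν j,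
      (IsUnit.mul ?_ ((hY.pow _).mul (hY.pow _))).mul
      (Finset.prod_induction _ _ (fun _ _ => IsUnit.mul) isUnit_one fun j _ => (hU j).pow _), ?_⟩
    · rw [isUnit_iff_cf, cf_zero_zero, constantCoeff_C]
      exact hc
    have hj : ∀ j, σ (X 0 ^ q - C (μ j) * X 1 ^ p) ^ ν j =
        X 0 ^ (p * q * ν j) * (X 1 ^ (if μ j = m then ν j else 0) * U j ^ ν j) := by
      intro j
      have : σ (X 0 ^ q - C (μ j) * X 1 ^ p) =
          X 0 ^ (p * q) * ((if μ j = m then X 1 else 1) * U j) := by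
        rw [← hfact j, map_sub, map_mul, map_pow, map_pow, algHom_C, hnHom_X0, hnHom_X1,
          show hnY p q m = Y from rfl]
        ring
      rw [this, mul_pow, ← pow_mul, mul_pow]
      split_ifs <;> simp
    rw [hfac, map_mul, map_mul, map_mul, map_pow, map_pow, algHom_C, map_prod, hnHom_X0, hnHom_X1]
    simp only [map_pow, hj]
    rw [Finset.prod_mul_distrib, Finset.prod_mul_distrib, Finset.prod_pow_eq_pow_sum,
      Finset.prod_pow_eq_pow_sum, ← Finset.mul_sum, hw,
      show hnY p q m = Y from rfl]
    ring
  refine ⟨V, R, hV, ?_⟩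
  rw [← sub_add_cancel f (faceForm p q f), map_add, hR, h1, pow_succ]
  ring_nf

/-- The face lies in columns from `N` on, and `(N, e)` is not below its supporting line, so its top
is at height at most `e`. This bounds `p * ∑ νⱼ` by `e`. -/
theorem IsFace.le_of_hasForm {f : Series K} {p q a b r N e : ℕ} (hq : 0 < q)
    (h : IsFace (supp f) p q a b r) (hf : HasForm f N e) : b + p * r ≤ e := by
  obtain ⟨h1, -, h3⟩ := hasForm_iff.mp hf
  have ha : N ≤ a := by
    by_contra ha
    exact h.top_mem (h1 a _ (by omega))
  have := h.le (N, e) h3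
  simp only at this
  have : p * N ≤ p * a := Nat.mul_le_mul_left _ ha
  exact Nat.le_of_mul_le_mul_left (by omega) hq

/-- The order of the strict transform is at most the order divided by `p`. -/
theorem HasForm.hnTransform [IsAlgClosed K] {f : Series K} {N e p q : ℕ} (hf : HasForm f N e)
    (hp : 0 < p) (hq : 0 < q) (hpq : Nat.Coprime p q) {m : K} (hm : m ≠ 0) :
    ∃ e', p * e' ≤ e ∧ HasForm (hnTransform p q m f) (weight p q f) e' := by
  classical
  obtain ⟨n, μ, ν, h⟩ := exists_isFaceFactorization hf.ne_zero hp hq hpq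
  refine ⟨_, ?_, h.hasForm_hnTransform hp hq hpq hm⟩
  obtain ⟨-, hμ, -, c, a, b, hc, hfac⟩ := h
  have h1 := (IsFaceFactorization.isFace hq hμ hc hfac).1.le_of_hasForm hq hf
  have h2 : (∑ j, if μ j = m then ν j else 0) ≤ ∑ j, ν j :=
    Finset.sum_le_sum fun j _ => by split_ifs <;> omega
  have := Nat.mul_le_mul_left p h2
  omega

/-! ### Infinite sequences of transforms of constant order -/

/-- The composition of the first `n` members of a sequence of algebra endomorphisms. -/
def iterHom (σ : ℕ → Series K →ₐ[K] Series K) : ℕ → Series K →ₐ[K] Series K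
  | 0 => AlgHom.id K _
  | n + 1 => (σ n).comp (iterHom σ n)

/-- A power series in `x` alone. -/
def seriesX (c : ℕ → K) : Series K := ofCf fun i j => if j = 0 then c i else 0

section

variable {σ : ℕ → Series K →ₐ[K] Series K}
  (hX : ∀ k, ∃ u, IsUnit u ∧ σ k (X 0) = X 0 * u) (hY : ∀ k, X 0 ∣ σ k (X 1))

include hX

theorem iterHom_X0 (k : ℕ) : ∃ u, IsUnit u ∧ iterHom σ k (X 0) = X 0 * u := by
  induction k with
  | zero => exact ⟨1, isUnit_one, by simp [iterHom]⟩
  | succ k ih =>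
    obtain ⟨u, hu, h⟩ := ih
    obtain ⟨v, hv, h'⟩ := hX k
    exact ⟨v * σ k u, hv.mul (hu.map _), by
      change σ k (iterHom σ k (X 0)) = _
      rw [h, map_mul, h', mul_assoc]⟩

/-- The image of `f` is `X ^ n * b`. Subtracting a suitable `c * x ^ n` removes the constant term of
the cofactor, and the next substitution sends a series without constant term to a multiple of `X`.
-/
theorem exists_coeff_step (hY : ∀ k, X 0 ∣ σ k (X 1)) {n : ℕ} {f : Series K}
    (h : X 0 ^ n ∣ iterHom σ n f) :
    ∃ c : K, X 0 ^ (n + 1) ∣ iterHom σ (n + 1) (f - C c * X 0 ^ n) := by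
  obtain ⟨b, hb⟩ := h
  obtain ⟨u, hu, hux⟩ := iterHom_X0 hX n
  have hu0 : cf 0 0 (u ^ n) ≠ 0 := isUnit_iff_cf.mp (hu.pow n)
  refine ⟨cf 0 0 b / cf 0 0 (u ^ n), ?_⟩
  set c := cf 0 0 b / cf 0 0 (u ^ n)
  have hc : cf 0 0 (b - C c * u ^ n) = 0 := by
    rw [map_sub, cf_C_mul, div_mul_cancel₀ _ hu0, sub_self]
  change _ ∣ σ n (iterHom σ n _)
  have : iterHom σ n (f - C c * X 0 ^ n) = X 0 ^ n * (b - C c * u ^ n) := by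
    rw [map_sub, map_mul, map_pow, algHom_C, hb, hux]; ring
  rw [this, map_mul, pow_succ]
  obtain ⟨v, hv, hvx⟩ := hX n
  refine mul_dvd_mul ?_ ?_
  · rw [map_pow, hvx, mul_pow]; exact Dvd.intro _ rfl
  · rw [exists_decomposition (b - C c * u ^ n), hc, map_zero, zero_add, map_add, map_mul, map_mul]
    exact dvd_add (((Dvd.intro _ rfl : X 0 ∣ X 0 * v).trans (dvd_of_eq hvx.symm)).mul_right _)
      ((hY n).mul_right _)

/-- The successive corrections form one series in `x`. Its tail from degree `n` on is divisible by
`x ^ n`, hence harmless at stage `n`, since `x` stays `X` times a unit. -/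
theorem exists_seriesX (hY : ∀ k, X 0 ∣ σ k (X 1)) :
    ∃ c : ℕ → K, ∀ n, X 0 ^ n ∣ iterHom σ n (X 1 - seriesX c) := by
  choose c hc using fun n (f : {f : Series K // X 0 ^ n ∣ iterHom σ n f}) =>
    exists_coeff_step hX hY f.2
  let a : ∀ n, {f : Series K // X 0 ^ n ∣ iterHom σ n f} := fun n =>
    Nat.rec ⟨X 1, by simp⟩ (fun n f => ⟨f.1 - C (c n f) * X 0 ^ n, hc n f⟩) n
  have ha : ∀ n, (a (n + 1)).1 = (a n).1 - C (c n (a n)) * X 0 ^ n := fun n => rfl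
  have hcf : ∀ n i j, cf i j (a n).1 =
      cf i j (X 1) - if i < n ∧ j = 0 then c i (a i) else 0 := by
    intro n i j
    induction n with
    | zero => simp [a]
    | succ n ih =>
      have h1 := cf_X0_pow_mul n i j (C (c n (a n)))
      rw [cf_C] at h1
      rw [ha, map_sub, ih, mul_comm, h1]
      by_cases hj : j = 0
      · rcases lt_trichotomy i n with h | rfl | h
        · simp [hj, h, Nat.lt_succ_of_lt h, Nat.not_le.mpr h]
        · simp [hj]
        · have h2 : ¬ i < n := by omega
          have h3 : ¬ i < n + 1 := by omega
          have h4 : i - n ≠ 0 := by omega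
          simp [h2, h3, h4]
      · simp [hj]
  refine ⟨fun n => c n (a n), fun n => ?_⟩
  have h1 : X 0 ^ n ∣ (X 1 - seriesX fun n => c n (a n)) - (a n).1 := by
    rw [X0_pow_dvd_iff]
    intro i j hi
    rw [map_sub, map_sub, hcf, seriesX, cf_ofCf]
    simp [hi]
  have h2 : X 0 ^ n ∣ iterHom σ n ((X 1 - seriesX fun n => c n (a n)) - (a n).1) := by
    obtain ⟨u, hu, hux⟩ := iterHom_X0 hX n
    have := map_dvd (iterHom σ n) h1
    rw [map_pow, hux, mul_pow] at this
    exact (Dvd.intro _ rfl).trans this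
  rw [map_sub] at h2
  exact (dvd_sub_left (a n).2).mp h2

/-- If a sequence of transforms of `f` keeps the order `d ≥ 2`, then `f` is divisible by the
square of a power series `y - φ(x)`. -/
theorem exists_sq_dvd_of_hasForm (hY : ∀ k, X 0 ∣ σ k (X 1))
    (hform : ∀ k a M e, HasForm a M e → ∃ M' e', e' ≤ e ∧ HasForm (σ k a) M' e')
    {f : Series K} {d : ℕ} (hd : 2 ≤ d) (hf : ∀ k, ∃ N, HasForm (iterHom σ k f) N d) :
    ∃ w, HasForm w 0 1 ∧ w ^ 2 ∣ f := by
  obtain ⟨c, hc⟩ := exists_seriesX hX hY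
  set w := X 1 - seriesX c with hw
  have hwcf : ∀ j, cf 0 j w = (if j = 1 then 1 else 0) - if j = 0 then c 0 else 0 := by
    intro j
    have h1 := cf_X1_pow_mul 1 0 j (1 : Series K)
    have h2 := cf_C (K := K) 0 (j - 1) 1
    rw [map_one C] at h2
    rw [pow_one, mul_one, h2] at h1
    rw [hw, map_sub, h1, seriesX, cf_ofCf]
    rcases j with _ | _ | j <;> simp
  have hw0 : c 0 = 0 := by
    by_contra h
    have hu : IsUnit w := by
      rw [isUnit_iff_cf, hwcf]; simpa using h
    have h1 := isUnit_iff_cf.mp (hu.map (iterHom σ 1))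
    exact h1 (X0_pow_dvd_iff.mp (hc 1) 0 0 one_pos)
  have hw1 : HasForm w 0 1 := by
    rw [hasForm_iff]
    refine ⟨fun i j h => absurd h (Nat.not_lt_zero _), fun j hj => ?_, ?_⟩
    · rw [hwcf]; simp [Nat.lt_one_iff.mp hj, hw0]
    · rw [hwcf]; simp
  have hwk : ∀ k, ∃ M e, e ≤ 1 ∧ HasForm (iterHom σ k w) M e := by
    intro k
    induction k with
    | zero => exact ⟨0, 1, le_rfl, hw1⟩
    | succ k ih =>
      obtain ⟨M, e, he, h⟩ := ih
      obtain ⟨M', e', he', h'⟩ := hform k _ M e h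
      exact ⟨M', e', he'.trans he, h'⟩
  -- If the order `e` stays positive, both terms of `Y ^ e * U + X * G` become divisible by `X`
  -- under the next substitution, so each step gains a factor `X`.
  have hgrow : ∀ g : Series K, (∀ k, ∃ N e, 0 < e ∧ HasForm (iterHom σ k g) N e) →
      ∀ k, X 0 ^ k ∣ iterHom σ k g := by
    intro g hg k
    induction k with
    | zero => simp
    | succ k ih =>
      obtain ⟨N, e, he, hN⟩ := hg k
      have hkN := hN.le_of_dvd ih
      obtain ⟨U, G, hU, h⟩ := hN
      obtain ⟨v, hv, hvx⟩ := hX k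
      change _ ∣ σ k (iterHom σ k g)
      rw [h, map_mul, map_pow, hvx, map_add, map_mul, map_mul, map_pow, hvx, pow_succ, mul_pow]
      refine mul_dvd_mul ((pow_dvd_pow _ hkN).mul_right _) (dvd_add ?_ ?_)
      · exact ((hY k).trans (dvd_pow_self _ he.ne')).mul_right _
      · exact (Dvd.intro _ rfl : X 0 ∣ X 0 * v).mul_right _
  -- The remainder modulo `w` involves `x` only. If nonzero, it is `x ^ m` times a unit, and its
  -- images are never divisible by `X ^ (m + 1)`.
  have hdvd : ∀ g : Series K, (∀ k, X 0 ^ k ∣ iterHom σ k g) → w ∣ g := by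
    intro g hg
    obtain ⟨a, r, rfl, hr⟩ := exists_weierstrass_division hw1 g
    have hr' : ∀ k, X 0 ^ k ∣ iterHom σ k r := by
      intro k
      have h1 := hg k
      rw [map_add, map_mul] at h1
      exact (dvd_add_right ((hc k).mul_right _)).mp h1
    rcases eq_or_ne r 0 with rfl | h0
    · rw [add_zero]; exact Dvd.intro _ rfl
    exfalso
    obtain ⟨m, e, h⟩ := exists_hasForm h0
    obtain ⟨V, hV, hVr⟩ : ∃ V, IsUnit V ∧ r = X 0 ^ m * V := by
      obtain ⟨V, rfl⟩ := h.dvd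
      refine ⟨V, ?_, rfl⟩
      have h1 := ((hasForm_X0_pow m).of_mul_left h).2.2
      rw [Nat.sub_self, Nat.sub_zero] at h1
      have he : e = 0 := by
        by_contra he
        exact (hasForm_iff.mp h).2.2 (hr m e (Nat.one_le_iff_ne_zero.mpr he))
      rw [he] at h1
      exact h1.isUnit
    obtain ⟨u, hu, hux⟩ := iterHom_X0 hX (m + 1)
    have h2 := hr' (m + 1)
    rw [hVr, map_mul, map_pow, hux, mul_pow, mul_assoc] at h2
    have h3 := (hasForm_X0_pow m).mul (IsUnit.hasForm ((hu.pow m).mul (hV.map (iterHom σ (m + 1)))))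
    have := h3.le_of_dvd h2
    omega
  obtain ⟨g, rfl⟩ := hdvd f (hgrow f fun k => by
    obtain ⟨N, h⟩ := hf k
    exact ⟨N, d, by omega, h⟩)
  -- The images of `w` have order at most `1` and those of `f` order `d ≥ 2`, so the cofactor `g`
  -- keeps positive order and is divisible by `w` as well.
  obtain ⟨g', rfl⟩ := hdvd g (hgrow g fun k => by
    obtain ⟨N, h⟩ := hf k
    obtain ⟨M, e, he, h'⟩ := hwk k
    rw [map_mul] at h
    exact ⟨_, _, by omega, (h'.of_mul_left h).2.2⟩)
  exact ⟨w, hw1, g', by ring⟩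

end

/-! ### Well-foundedness of the construction -/

/-- `h` is a Hamburger–Noether transform of `g` at a multiple root, and both have the properties of
the power series to which the construction is applied after the first step. -/
structure IsStep (h g : Series K) : Prop where
  reduced : LogReducedX g
  exists_eq : ∃ (p q : ℕ) (m : K), 0 < p ∧ 0 < q ∧ Nat.Coprime p q ∧ m ≠ 0 ∧ h = hnTransform p q m g
  exists_hasForm : ∃ N e, 2 ≤ e ∧ HasForm h N e

/-- Along an infinite chain the orders are eventually constant, and the limiting centre gives a
square factor `w ^ 2`. Reducedness makes `w` divide a power of `x`, impossible for a series of
positive order on `x = 0`. -/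
theorem isStep_wellFounded [IsAlgClosed K] : WellFounded (IsStep (K := K)) := by
  rw [wellFounded_iff_isEmpty_descending_chain]
  refine ⟨fun ⟨F, hF⟩ => ?_⟩
  choose p q m hp hq hpq hm hF' using fun k => (hF k).exists_eq
  have hform : ∀ k, ∃ N e, 2 ≤ e ∧ HasForm (F (k + 1)) N e := fun k => (hF k).exists_hasForm
  choose N e he hNe using hform
  have hle : ∀ k, p (k + 1) * e (k + 1) ≤ e k := by
    intro k
    obtain ⟨e', he', h⟩ := (hNe k).hnTransform (hp (k + 1)) (hq (k + 1)) (hpq (k + 1)) (hm (k + 1))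
    rw [← hF'] at h
    rwa [(hNe (k + 1)).unique h |>.2]
  have hanti : Antitone e := antitone_nat_of_succ_le fun k =>
    (Nat.le_mul_of_pos_left _ (hp (k + 1))).trans (hle k)
  obtain ⟨k0, hk0⟩ : ∃ k0, ∀ k, k0 ≤ k → e k = e k0 := by
    classical
    have hex : ∃ v k, e k = v := ⟨_, 0, rfl⟩
    obtain ⟨k0, hk0⟩ := Nat.find_spec hex
    exact ⟨k0, fun k hk => le_antisymm (hanti hk) (hk0 ▸ Nat.find_min' hex ⟨k, rfl⟩)⟩
  -- From `p * e ≤ e` with `e ≥ 2`. This is what makes the later substitutions send `x` to `X` times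
  -- a unit.
  have hp1 : ∀ k, k0 ≤ k → p (k + 1) = 1 := by
    intro k hk
    have h1 := hle k
    rw [hk0 k hk, hk0 (k + 1) (by omega)] at h1
    have h2 := he k0
    have h3 := hp (k + 1)
    by_contra h
    have : 2 * e k0 ≤ p (k + 1) * e k0 := Nat.mul_le_mul_right _ (by omega)
    omega
  let σ : ℕ → Series K →ₐ[K] Series K := fun k =>
    hnHom (hp (k0 + k + 1)) (hq (k0 + k + 1)) (m (k0 + k + 1))
  have hiter : ∀ k, iterHom σ k (F (k0 + 1)) = F (k0 + k + 1) := by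
    intro k
    induction k with
    | zero => rfl
    | succ k ih =>
      change σ k (iterHom σ k _) = _
      rw [ih, hnHom_apply, ← hF']; rfl
  have hsq : ∃ w, HasForm w 0 1 ∧ w ^ 2 ∣ F (k0 + 1) := by
    refine exists_sq_dvd_of_hasForm (σ := σ) (fun k => ?_) (fun k => ?_) (fun k a M e' h => ?_)
      (he k0) (fun k => ⟨N (k0 + k), ?_⟩)
    · refine ⟨hnY (p (k0 + k + 1)) (q (k0 + k + 1)) (m (k0 + k + 1)) ^
        (hnExp (p (k0 + k + 1)) (q (k0 + k + 1))).2, (hnY_isUnit (hm (k0 + k + 1))).pow _, ?_⟩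
      rw [hnHom_X0, hp1 (k0 + k) (by omega), pow_one]
    · rw [hnHom_X1]
      exact (dvd_pow_self _ (hq _).ne').mul_right _
    · obtain ⟨e'', h1, h2⟩ := h.hnTransform (hp (k0 + k + 1)) (hq (k0 + k + 1))
        (hpq (k0 + k + 1)) (hm (k0 + k + 1))
      refine ⟨_, e'', ?_, by rw [hnHom_apply]; exact h2⟩
      exact (Nat.le_mul_of_pos_left _ (hp (k0 + k + 1))).trans h1
    · rw [hiter, ← hk0 (k0 + k) (by omega)]
      exact hNe _
  obtain ⟨w, hw, hwd⟩ := hsq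
  obtain ⟨n, hn⟩ := (hF (k0 + 1)).reduced.dvd_of_sq_dvd hwd
  exact hw.not_dvd_X0_pow one_pos n hn

/-! ### The chain of edges of a Newton polygon -/

/-- The point `(x, y)` is the lowest point of `S` at which `p X + q Y` is minimal. -/
structure IsCorner (S : Set (ℕ × ℕ)) (x y p q : ℕ) : Prop where
  mem : (x, y) ∈ S
  le : ∀ z ∈ S, p * x + q * y ≤ p * z.1 + q * z.2
  le_snd : ∀ z ∈ S, p * z.1 + q * z.2 = p * x + q * y → y ≤ z.2

/-- The list `es` of directions of consecutive faces of `S` leads from `(x, y)` to `(x', y')`. -/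
inductive EdgeChain (S : Set (ℕ × ℕ)) : ℕ → ℕ → List (ℕ × ℕ) → ℕ → ℕ → Prop
  | nil (x y : ℕ) : EdgeChain S x y [] x y
  | cons {x b p q r x' y' : ℕ} {es : List (ℕ × ℕ)} (hp : 0 < p) (hq : 0 < q) (hr : 0 < r)
      (hface : IsFace S p q x b r) (htail : EdgeChain S (x + q * r) b es x' y') :
      EdgeChain S x (b + p * r) ((p, q) :: es) x' y'

/-- Only finitely many rows lie below the corner, and the leftmost point of each suffices. Ties in
the quotient are broken by the lowest row, so that the point found is the bottom end of the next
edge. Cross-multiplication avoids quotients in the conclusion. -/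
theorem IsCorner.exists_min_slope {S : Set (ℕ × ℕ)} {x y p q : ℕ} (h : IsCorner S x y p q)
    (hlow : ∃ z ∈ S, z.2 < y) :
    ∃ i0 j0, (i0, j0) ∈ S ∧ j0 < y ∧ x < i0 ∧ p * x + q * y < p * i0 + q * j0 ∧
      ∀ z ∈ S, z.2 < y → ((i0 : ℤ) - x) * (y - z.2) ≤ (z.1 - x) * (y - j0) ∧
        (((i0 : ℤ) - x) * (y - z.2) = (z.1 - x) * (y - j0) → j0 ≤ z.2) := by
  classical
  have hgt : ∀ z ∈ S, z.2 < y → x < z.1 ∧ p * x + q * y < p * z.1 + q * z.2 := by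
    intro z hz hzy
    have h1 : p * x + q * y < p * z.1 + q * z.2 :=
      lt_of_le_of_ne (h.le z hz) fun he => absurd (h.le_snd z hz he.symm) (by omega)
    refine ⟨?_, h1⟩
    by_contra hx
    have h2 := Nat.mul_le_mul_left p (not_lt.mp hx)
    have h3 := Nat.mul_le_mul_left q hzy.le
    omega
  let m : ℕ → ℕ := fun j => sInf {i | (i, j) ∈ S}
  have hm : ∀ z ∈ S, (m z.2, z.2) ∈ S ∧ m z.2 ≤ z.1 := fun z hz =>
    ⟨Nat.sInf_mem (s := {i | (i, z.2) ∈ S}) ⟨z.1, hz⟩, Nat.sInf_le hz⟩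
  let J := (Finset.range y).filter fun j => ∃ i, (i, j) ∈ S
  obtain ⟨j0, hj0, hmin⟩ := Finset.exists_min_image J
    (fun j => toLex (((m j : ℚ) - x) / (y - j), j)) (by
      obtain ⟨z, hz, hzy⟩ := hlow
      exact ⟨z.2, Finset.mem_filter.mpr ⟨Finset.mem_range.mpr hzy, z.1, hz⟩⟩)
  obtain ⟨hj0y, i, hi⟩ := Finset.mem_filter.mp hj0
  rw [Finset.mem_range] at hj0y
  have hmem := (hm _ hi).1
  have h0 := hgt _ hmem hj0y
  refine ⟨m j0, j0, hmem, hj0y, h0.1, h0.2, fun z hz hzy => ?_⟩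
  have h1 := hmin z.2 (Finset.mem_filter.mpr ⟨Finset.mem_range.mpr hzy, z.1, hz⟩)
  rw [Prod.Lex.toLex_le_toLex] at h1
  have hy0 : (0 : ℚ) < y - j0 := by rw [sub_pos]; exact_mod_cast hj0y
  have hy1 : (0 : ℚ) < y - z.2 := by rw [sub_pos]; exact_mod_cast hzy
  simp only [div_lt_div_iff₀ hy0 hy1, div_eq_div_iff hy0.ne' hy1.ne'] at h1
  have hmz : ((m z.2 : ℤ) - x) * (y - j0) ≤ (z.1 - x) * (y - j0) := by
    apply mul_le_mul_of_nonneg_right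
    · have := (hm z hz).2
      omega
    · omega
  rcases h1 with h1 | ⟨h1, h2⟩
  · have h1' : ((m j0 : ℤ) - x) * (y - z.2) < ((m z.2 : ℤ) - x) * (y - j0) := by exact_mod_cast h1
    exact ⟨by linarith, fun he => by linarith⟩
  · have h1' : ((m j0 : ℤ) - x) * (y - z.2) = ((m z.2 : ℤ) - x) * (y - j0) := by exact_mod_cast h1
    exact ⟨by linarith, fun _ => h2⟩

theorem IsCorner.exists_next {S : Set (ℕ × ℕ)} {x y p q : ℕ} (h : IsCorner S x y p q) (hp : 0 < p)
    (hlow : ∃ z ∈ S, z.2 < y) :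
    ∃ p' q' b r, 0 < p' ∧ 0 < q' ∧ 0 < r ∧ Nat.Coprime p' q' ∧ p' * q < p * q' ∧
      y = b + p' * r ∧ IsFace S p' q' x b r ∧ IsCorner S (x + q' * r) b p' q' := by
  obtain ⟨i0, j0, hmem, hjy, hxi, hlt, hmin⟩ := h.exists_min_slope hlow
  obtain ⟨u, rfl⟩ := Nat.exists_eq_add_of_lt hjy
  obtain ⟨v, rfl⟩ := Nat.exists_eq_add_of_lt hxi
  obtain ⟨r, p', q', hr, hco, hu, hv⟩ := Nat.exists_coprime' (m := u + 1) (n := v + 1)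
    (Nat.gcd_pos_of_pos_left _ (Nat.succ_pos u))
  have hp' : 0 < p' := Nat.pos_of_ne_zero fun h0 => by simp [h0] at hu
  have hq' : 0 < q' := Nat.pos_of_ne_zero fun h0 => by simp [h0] at hv
  have hslope : p' * q < p * q' := by
    have : p' * q * r < p * q' * r := by
      have h1 : q * (u + 1) < p * (v + 1) := by
        simp only [mul_add, mul_one] at hlt ⊢; omega
      rw [hu, hv] at h1
      nlinarith
    exact Nat.lt_of_mul_lt_mul_right this
  have hu' : (u : ℤ) + 1 = p' * r := by exact_mod_cast hu
  have hv' : (v : ℤ) + 1 = q' * r := by exact_mod_cast hv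
  have hr' : (0 : ℤ) < r := by exact_mod_cast hr
  have hp0 : (0 : ℤ) < p := by exact_mod_cast hp
  have hp0' : (0 : ℤ) < p' := by exact_mod_cast hp'
  have hq0' : (0 : ℤ) < q' := by exact_mod_cast hq'
  have hs' : (p' : ℤ) * q < p * q' := by exact_mod_cast hslope
  -- Below the corner this is the minimality of the slope; at or above it, the old supporting line
  -- does the work, since the new one passes through the same corner and is less steep.
  have key : ∀ z ∈ S, (q' : ℤ) * (j0 + u + 1 - z.2) ≤ p' * (z.1 - x) ∧
      ((q' : ℤ) * (j0 + u + 1 - z.2) = p' * (z.1 - x) → x ≤ z.1 ∧ j0 ≤ z.2) := by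
    intro z hz
    rcases lt_or_ge z.2 (j0 + u + 1) with hzy | hzy
    · obtain ⟨h1, h2⟩ := hmin z hz hzy
      push_cast at h1 h2
      have e1 : ((x : ℤ) + v + 1 - x) * (j0 + u + 1 - z.2) = r * (q' * (j0 + u + 1 - z.2)) := by
        linear_combination ((j0 : ℤ) + u + 1 - z.2) * hv'
      have e2 : ((z.1 : ℤ) - x) * (j0 + u + 1 - j0) = r * (p' * (z.1 - x)) := by
        linear_combination ((z.1 : ℤ) - x) * hu'
      rw [e1, e2] at h1 h2
      refine ⟨le_of_mul_le_mul_left h1 hr', fun he => ⟨?_, h2 (by rw [he])⟩⟩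
      have h3 : (0 : ℤ) ≤ p' * (z.1 - x) := by
        rw [← he]
        exact mul_nonneg hq0'.le (by omega)
      have := nonneg_of_mul_nonneg_right h3 hp0'
      omega
    · have h1 : (p : ℤ) * x + q * (j0 + u + 1) ≤ p * z.1 + q * z.2 := by
        exact_mod_cast h.le z hz
      have hz0 : (0 : ℤ) ≤ z.2 - (j0 + u + 1) := by omega
      have h2 : (p' : ℤ) * q * (z.2 - (j0 + u + 1)) ≤ p * q' * (z.2 - (j0 + u + 1)) :=
        mul_le_mul_of_nonneg_right hs'.le hz0
      have h3 : (p' : ℤ) * (p * (x - z.1)) ≤ p' * (q * (z.2 - (j0 + u + 1))) :=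
        mul_le_mul_of_nonneg_left (by linarith) hp0'.le
      have h4 : (p : ℤ) * (p' * (x - z.1)) ≤ p * (q' * (z.2 - (j0 + u + 1))) := by linarith
      have h5 := le_of_mul_le_mul_left h4 hp0
      refine ⟨by linarith, fun he => ⟨?_, by omega⟩⟩
      by_contra hx
      have h6 : (0 : ℤ) < p' * (x - z.1) := mul_pos hp0' (by omega)
      have h7 : (0 : ℤ) < q' * (z.2 - (j0 + u + 1)) := by linarith
      have h8 := pos_of_mul_pos_right h7 hq0'.le
      have h9 : (p' : ℤ) * q * (z.2 - (j0 + u + 1)) < p * q' * (z.2 - (j0 + u + 1)) :=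
        mul_lt_mul_of_pos_right hs' h8
      have h10 : (p : ℤ) * (q' * (z.2 - (j0 + u + 1))) = p * (p' * (x - z.1)) := by
        congr 1; linarith
      linarith
  have hju : j0 + u + 1 = j0 + p' * r := by omega
  have hxv : x + v + 1 = x + q' * r := by omega
  have hjz : (j0 : ℤ) + u + 1 = j0 + p' * r := by linarith
  rw [hxv] at hmem
  have hle : ∀ z ∈ S, p' * x + q' * (j0 + p' * r) ≤ p' * z.1 + q' * z.2 := by
    intro z hz
    have := (key z hz).1
    rw [hjz] at this
    zify
    linarith
  have heq : ∀ z ∈ S, p' * z.1 + q' * z.2 = p' * x + q' * (j0 + p' * r) → x ≤ z.1 ∧ j0 ≤ z.2 := by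
    intro z hz he
    have h2 := (key z hz).2
    rw [hjz] at h2
    zify at he
    exact h2 (by linarith)
  have hc : p' * (x + q' * r) + q' * j0 = p' * x + q' * (j0 + p' * r) := by ring
  refine ⟨p', q', j0, r, hp', hq', hr, hco, hslope, hju, ⟨hju ▸ h.mem, hmem, hle, ?_⟩,
    hmem, fun z hz => hc ▸ hle z hz, fun z hz he => (heq z hz (he.trans hc)).2⟩
  intro z hz he
  obtain ⟨h1, h2⟩ := heq z hz he
  refine ⟨h1, ?_⟩
  rw [← hc] at he
  have := Nat.mul_le_mul_left q' h2
  exact Nat.le_of_mul_le_mul_left (by omega : p' * z.1 ≤ p' * (x + q' * r)) hp'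

theorem isEdge_iff {f : Series K} {p q : ℕ} :
    IsEdge f (p, q) ↔ 0 < p ∧ 0 < q ∧ Nat.Coprime p q ∧
      ∃ z ∈ supp f, ∃ w ∈ supp f, z ≠ w ∧ p * w.1 + q * w.2 = p * z.1 + q * z.2 ∧
        ∀ v ∈ supp f, p * z.1 + q * z.2 ≤ p * v.1 + q * v.2 := by
  refine and_congr_right fun _ => and_congr_right fun _ => and_congr_right fun _ => ?_
  constructor
  · rintro ⟨z, hz, w, hw, hne, h1, h2⟩
    exact ⟨z, hz, w, hw, hne, h2.trans h1.symm, fun v hv => h1 ▸ weight_le p q hv⟩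
  · rintro ⟨z, hz, w, hw, hne, h1, h2⟩
    have h3 : p * z.1 + q * z.2 = weight p q f := by
      obtain ⟨v, hv, h⟩ := Nat.sInf_mem (s := {N | ∃ z ∈ supp f, N = p * z.1 + q * z.2})
        ⟨_, z, hz, rfl⟩
      exact le_antisymm ((h2 v hv).trans h.ge) (weight_le p q hz)
    exact ⟨z, hz, w, hw, hne, h3, h1.trans h3⟩

theorem IsFace.isEdge {f : Series K} {p q a b r : ℕ} (h : IsFace (supp f) p q a b r) (hp : 0 < p)
    (hq : 0 < q) (hr : 0 < r) (hpq : Nat.Coprime p q) : IsEdge f (p, q) := by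
  refine isEdge_iff.mpr ⟨hp, hq, hpq, _, h.top_mem, _, h.bot_mem, ?_, by ring, h.le⟩
  intro he
  have := congrArg Prod.snd he
  have h1 := Nat.mul_pos hp hr
  simp only at this
  omega

/-- An edge with smaller slope than a corner starts at or below the corner. -/
theorem IsCorner.exists_lt_of_isEdge {f : Series K} {x y p q p' q' : ℕ}
    (h : IsCorner (supp f) x y p q) (hp : 0 < p) (he : IsEdge f (p', q')) (hlt : p' * q < p * q') :
    ∃ z ∈ supp f, z.2 < y ∧ p' * z.1 + q' * z.2 ≤ p' * x + q' * y := by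
  obtain ⟨hp', hq', -, z, hz, w, hw, hne, hzw, hmin⟩ := isEdge_iff.mp he
  by_contra hcon
  push Not at hcon
  have key : ∀ v ∈ supp f, p' * v.1 + q' * v.2 = p' * z.1 + q' * z.2 → v = (x, y) := by
    intro v hv hvz
    have h1 : p' * v.1 + q' * v.2 ≤ p' * x + q' * y := hvz ▸ hmin _ h.mem
    have h2 : y ≤ v.2 := by
      by_contra hy
      exact absurd h1 (not_le.mpr (hcon v hv (by omega)))
    have h3 := h.le v hv
    zify at h1 h2 h3 hlt hp hp' hq'
    have h4 : (p : ℤ) * (q' * (v.2 - y)) ≤ p * (p' * (x - v.1)) :=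
      mul_le_mul_of_nonneg_left (by linarith) hp.le
    have h5 : (p' : ℤ) * (p * (x - v.1)) ≤ p' * (q * (v.2 - y)) :=
      mul_le_mul_of_nonneg_left (by linarith) hp'.le
    have h6 : ((p : ℤ) * q' - p' * q) * (v.2 - y) ≤ 0 := by linarith
    have h7 : (v.2 : ℤ) - y ≤ 0 := nonpos_of_mul_nonpos_right h6 (by linarith)
    have h8 : (v.2 : ℤ) = y := by linarith
    rw [h8] at h1 h3
    have h9 : (v.1 : ℤ) ≤ x := le_of_mul_le_mul_left (by linarith) hp'
    have h10 : (x : ℤ) ≤ v.1 := le_of_mul_le_mul_left (by linarith) hp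
    ext
    · simp only; omega
    · simp only; omega
  exact hne ((key z hz rfl).trans (key w hw hzw).symm)

theorem IsFace.slope_le {f : Series K} {x b r p q p' q' : ℕ} (h : IsFace (supp f) p q x b r)
    (hq : 0 < q) {z : ℕ × ℕ} (hz : z ∈ supp f) (hzy : z.2 < b + p * r)
    (hle : p' * z.1 + q' * z.2 ≤ p' * x + q' * (b + p * r)) : p' * q ≤ p * q' := by
  have h1 := h.le z hz
  zify at h1 hzy hle hq ⊢
  rcases Nat.eq_zero_or_pos p with rfl | hp
  · have h2 : (z.2 : ℤ) < z.2 := by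
      refine lt_of_lt_of_le hzy ?_
      simp only [Nat.cast_zero, zero_mul, zero_add] at h1 ⊢
      exact le_of_mul_le_mul_left h1 hq
    exact absurd h2 (lt_irrefl _)
  · zify at hp
    have h2 : (p : ℤ) * (p' * (z.1 - x)) ≤ p * (q' * (b + p * r - z.2)) :=
      mul_le_mul_of_nonneg_left (by linarith) hp.le
    have h3 : (p' : ℤ) * (q * (b + p * r - z.2)) ≤ p' * (p * (z.1 - x)) :=
      mul_le_mul_of_nonneg_left (by linarith) (Int.natCast_nonneg _)
    exact le_of_mul_le_mul_right (by linarith : (p' : ℤ) * q * (b + p * r - z.2) ≤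
      p * q' * (b + p * r - z.2)) (by linarith)

theorem eq_of_coprime_of_mul_eq {p q p' q' : ℕ} (h : Nat.Coprime p q) (h' : Nat.Coprime p' q')
    (he : p' * q = p * q') : (p', q') = (p, q) := by
  have h1 : p' ∣ p := h'.dvd_of_dvd_mul_right (he ▸ Dvd.intro _ rfl)
  have h2 : p ∣ p' := h.dvd_of_dvd_mul_right (he ▸ Dvd.intro _ rfl)
  have h3 : q' ∣ q := h'.symm.dvd_of_dvd_mul_left (he ▸ Dvd.intro_left _ rfl)
  have h4 : q ∣ q' := h.symm.dvd_of_dvd_mul_left (he ▸ Dvd.intro_left _ rfl)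
  rw [Nat.dvd_antisymm h1 h2, Nat.dvd_antisymm h3 h4]

theorem slope_trans {p q p' q' p'' q'' : ℕ} (hq'' : 0 < q'')
    (h1 : p' * q < p * q') (h2 : p'' * q' ≤ p' * q'') : p'' * q < p * q'' := by
  have h3 : p'' * q' * q ≤ p' * q'' * q := Nat.mul_le_mul_right _ h2
  have h4 : p' * q * q'' < p * q' * q'' := Nat.mul_lt_mul_of_pos_right h1 hq''
  refine Nat.lt_of_mul_lt_mul_right (a := q') ?_
  calc p'' * q * q' = p'' * q' * q := by ring
    _ ≤ p' * q'' * q := h3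
    _ = p' * q * q'' := by ring
    _ < p * q' * q'' := h4
    _ = p * q'' * q' := by ring

/-- The next edge after a corner is the steepest of the remaining ones. -/
theorem IsCorner.mem_edges_iff {f : Series K} {x b r p q p' q' : ℕ}
    (h : IsCorner (supp f) x (b + p' * r) p q) (hp : 0 < p) (hp' : 0 < p') (hq' : 0 < q')
    (hr : 0 < r) (hpq : Nat.Coprime p' q') (hlt : p' * q < p * q')
    (hface : IsFace (supp f) p' q' x b r) (e : ℕ × ℕ) :
    IsEdge f e ∧ e.1 * q < p * e.2 ↔ e = (p', q') ∨ IsEdge f e ∧ e.1 * q' < p' * e.2 := by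
  constructor
  · rintro ⟨he, hs⟩
    obtain ⟨z, hz, hzy, hle⟩ := h.exists_lt_of_isEdge hp he hs
    rcases (hface.slope_le hq' hz hzy hle).eq_or_lt with h1 | h1
    · exact Or.inl (eq_of_coprime_of_mul_eq hpq he.2.2.1 h1)
    · exact Or.inr ⟨he, h1⟩
  · rintro (rfl | ⟨he, hs⟩)
    · exact ⟨hface.isEdge hp' hq' hr hpq, hlt⟩
    · exact ⟨he, slope_trans he.2.1 hlt hs.le⟩

theorem IsCorner.exists_edgeList {f : Series K} {x y p q : ℕ} (h : IsCorner (supp f) x y p q)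
    (hp : 0 < p) : ∃ es : List (ℕ × ℕ), (∀ e, e ∈ es ↔ IsEdge f e ∧ e.1 * q < p * e.2) ∧
      es.Pairwise fun e e' => e'.1 * e.2 < e.1 * e'.2 := by
  induction y using Nat.strong_induction_on generalizing x p q with
  | _ y ih =>
    by_cases hlow : ∃ z ∈ supp f, z.2 < y
    · obtain ⟨p', q', b, r, hp', hq', hr, hpq, hlt, rfl, hface, hc⟩ := h.exists_next hp hlow
      obtain ⟨es, h1, h2⟩ := ih b (Nat.lt_add_of_pos_right (Nat.mul_pos hp' hr)) hc hp'
      refine ⟨(p', q') :: es, fun e => ?_, List.pairwise_cons.mpr ⟨fun e he => ((h1 e).mp he).2, h2⟩⟩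
      rw [List.mem_cons, h1, h.mem_edges_iff hp hp' hq' hr hpq hlt hface]
    · refine ⟨[], fun e => ?_, List.Pairwise.nil⟩
      simp only [List.not_mem_nil, false_iff]
      rintro ⟨he, hs⟩
      obtain ⟨z, hz, hzy, -⟩ := h.exists_lt_of_isEdge hp he hs
      exact hlow ⟨z, hz, hzy⟩

/-- The head of a sorted list of the remaining edges must be the steepest one, which is the edge
found by `IsCorner.exists_next`; the tail is then the list for the next corner. -/
theorem IsCorner.edgeChain {f : Series K} {x y p q : ℕ} (h : IsCorner (supp f) x y p q)
    (hp : 0 < p) {es : List (ℕ × ℕ)} (hes : ∀ e, e ∈ es ↔ IsEdge f e ∧ e.1 * q < p * e.2)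
    (hsort : es.Pairwise fun e e' => e'.1 * e.2 < e.1 * e'.2) :
    ∃ x' y', EdgeChain (supp f) x y es x' y' ∧ (x', y') ∈ supp f ∧
      ∀ z ∈ supp f, y' ≤ z.2 ∧ (z.2 = y' → x' ≤ z.1) := by
  induction es generalizing x y p q with
  | nil =>
    by_cases hlow : ∃ z ∈ supp f, z.2 < y
    · obtain ⟨p', q', b, r, hp', hq', hr, hpq, hlt, rfl, hface, hc⟩ := h.exists_next hp hlow
      exact absurd ((hes _).mpr ⟨hface.isEdge hp' hq' hr hpq, hlt⟩) List.not_mem_nil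
    · refine ⟨x, y, .nil x y, h.mem, fun z hz => ⟨not_lt.mp fun hl => hlow ⟨z, hz, hl⟩, ?_⟩⟩
      intro he
      have := h.le z hz
      rw [he] at this
      exact Nat.le_of_mul_le_mul_left (Nat.le_of_add_le_add_right this) hp
  | cons e es ih =>
    have he := (hes e).mp List.mem_cons_self
    obtain ⟨z, hz, hzy, hle⟩ := h.exists_lt_of_isEdge hp he.1 he.2
    obtain ⟨p', q', b, r, hp', hq', hr, hpq, hlt, rfl, hface, hc⟩ := h.exists_next hp ⟨z, hz, hzy⟩
    rw [List.pairwise_cons] at hsort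
    have hiff := h.mem_edges_iff hp hp' hq' hr hpq hlt hface
    have hee : e = (p', q') := by
      rcases (hiff e).mp he with h1 | ⟨-, h1⟩
      · exact h1
      · rcases List.mem_cons.mp ((hes (p', q')).mpr ((hiff _).mpr (Or.inl rfl))) with h2 | h2
        · exact h2.symm
        · exact absurd (hsort.1 _ h2) (not_lt.mpr h1.le)
    subst hee
    obtain ⟨x', y', h1, h2⟩ := ih hc hp' (fun e => by
      constructor
      · intro h1
        exact ⟨((hes e).mp (List.mem_cons_of_mem _ h1)).1, hsort.1 e h1⟩
      · rintro h1
        have h2 := (hes e).mpr ((hiff e).mpr (Or.inr h1))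
        rcases List.mem_cons.mp h2 with rfl | h3
        · exact absurd h1.2 (lt_irrefl _)
        · exact h3) hsort.2
    exact ⟨x', y', .cons hp' hq' hr hface h1, h2⟩

/-- The vertical line `X = N` serves as the initial supporting line. Every compact edge is less
steep than the direction `(1, 0)`, so starting here excludes no edge. -/
theorem HasForm.isCorner {f : Series K} {N e : ℕ} (h : HasForm f N e) :
    IsCorner (supp f) N e 1 0 := by
  obtain ⟨h1, h2, h3⟩ := hasForm_iff.mp h
  have hN : ∀ z ∈ supp f, N ≤ z.1 := fun z hz => not_lt.mp fun hl => hz (h1 _ _ hl)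
  refine ⟨h3, fun z hz => by simpa using hN z hz, fun z hz he => not_lt.mp fun hl => hz ?_⟩
  simp only [one_mul, zero_mul, add_zero] at he
  have := h2 _ hl
  rwa [← he] at this

theorem HasForm.exists_isEdgeList {f : Series K} {N e : ℕ} (h : HasForm f N e) :
    ∃ es, IsEdgeList f es := by
  obtain ⟨es, h1, h2⟩ := h.isCorner.exists_edgeList one_pos
  refine ⟨es, fun e => (h1 e).trans ⟨fun h => h.1, fun h => ⟨h, ?_⟩⟩, h2⟩
  have := h.2.1
  simpa using this

theorem HasForm.edgeChain {f : Series K} {N e : ℕ} (h : HasForm f N e) {es : List (ℕ × ℕ)}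
    (hes : IsEdgeList f es) :
    ∃ x', EdgeChain (supp f) N e es x' (ordY f) ∧ (x', ordY f) ∈ supp f ∧
      ∀ z ∈ supp f, ordY f ≤ z.2 ∧ (z.2 = ordY f → x' ≤ z.1) := by
  obtain ⟨x', y', h1, h2, h3⟩ := h.isCorner.edgeChain one_pos (fun e => (hes.1 e).trans
    ⟨fun h => ⟨h, by simpa using h.2.1⟩, fun h => h.1⟩) hes.2
  have : ordY f = y' := le_antisymm (Nat.sInf_le ⟨x', h2⟩)
    (le_csInf ⟨y', x', h2⟩ fun j ⟨i, hij⟩ => (h3 _ hij).1)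
  rw [this]
  exact ⟨x', h1, h2, h3⟩

theorem HasForm.ordX_eq {f : Series K} {N e : ℕ} (h : HasForm f N e) : ordX f = N := by
  obtain ⟨h1, -, h3⟩ := hasForm_iff.mp h
  exact le_antisymm (Nat.sInf_le ⟨e, h3⟩)
    (le_csInf ⟨N, e, h3⟩ fun i ⟨j, hij⟩ => not_lt.mp fun hl => hij (h1 _ _ hl))

section Area

open MeasureTheory

/-! ### Areas under Newton polygons -/

theorem mem_newtonPolyhedron_of_le {S : Set (ℕ × ℕ)} {s : ℕ × ℕ} (hs : s ∈ S) {z : ℝ × ℝ}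
    (h1 : (s.1 : ℝ) ≤ z.1) (h2 : (s.2 : ℝ) ≤ z.2) : z ∈ newtonPolyhedron S :=
  subset_convexHull ℝ _ ⟨s, hs, h1, h2⟩

theorem le_of_mem_newtonPolyhedron {S : Set (ℕ × ℕ)} {p q c : ℝ} (hp : 0 ≤ p) (hq : 0 ≤ q)
    (h : ∀ s ∈ S, c ≤ p * s.1 + q * s.2) {z : ℝ × ℝ} (hz : z ∈ newtonPolyhedron S) :
    c ≤ p * z.1 + q * z.2 := by
  have hconv : Convex ℝ {z : ℝ × ℝ | c ≤ p * z.1 + q * z.2} := by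
    intro u hu v hv a b ha hb hab
    simp only [Set.mem_ofPred_eq, Prod.fst_add, Prod.snd_add, Prod.smul_fst, Prod.smul_snd,
      smul_eq_mul] at hu hv ⊢
    calc c = a * c + b * c := by rw [← add_mul, hab, one_mul]
      _ ≤ a * (p * u.1 + q * u.2) + b * (p * v.1 + q * v.2) :=
        add_le_add (mul_le_mul_of_nonneg_left hu ha) (mul_le_mul_of_nonneg_left hv hb)
      _ = _ := by ring
  refine convexHull_min ?_ hconv hz
  rintro z ⟨s, hs, h1, h2⟩
  exact (h s hs).trans
    (add_le_add (mul_le_mul_of_nonneg_left h1 hp) (mul_le_mul_of_nonneg_left h2 hq))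

/-- The region under a segment of the Newton polygon. -/
theorem strip_eq {S : Set (ℕ × ℕ)} {N x y u v : ℕ} (hN : N ≤ x) (hu : 0 < u)
    (h0 : (x, y + v) ∈ S) (h1 : (x + u, y) ∈ S)
    (hS : ∀ s ∈ S, v * x + u * (y + v) ≤ v * s.1 + u * s.2) :
    ({z : ℝ × ℝ | (N : ℝ) ≤ z.1 ∧ 0 ≤ z.2} \ newtonPolyhedron S) ∩ {z | (x : ℝ) ≤ z.1 ∧
      z.1 < x + u} = {z | z.1 ∈ Set.Ico (x : ℝ) (x + u) ∧
        z.2 ∈ Set.Ico 0 ((y : ℝ) + v - v / u * (z.1 - x))} := by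
  have hu' : (0 : ℝ) < u := by exact_mod_cast hu
  ext z
  simp only [Set.mem_inter_iff, Set.mem_sdiff, Set.mem_ofPred_eq, Set.mem_Ico]
  constructor
  · rintro ⟨⟨⟨-, hz2⟩, hz⟩, hx1, hx2⟩
    refine ⟨⟨hx1, hx2⟩, hz2, ?_⟩
    by_contra hcon
    rw [not_lt] at hcon
    apply hz
    set t : ℝ := (z.1 - x) / u with ht
    have ht0 : 0 ≤ t := div_nonneg (by linarith) hu'.le
    have ht1 : t ≤ 1 := by rw [ht, div_le_one hu']; linarith
    have htu : t * u = z.1 - x := div_mul_cancel₀ _ hu'.ne'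
    have hvt : (v : ℝ) / u * (z.1 - x) = v * t := by rw [ht]; ring
    rw [hvt] at hcon
    -- The height of `z` above the segment: raising both ends by `w` keeps them in the polyhedron
    -- and puts `z` on the segment between them.
    set w : ℝ := z.2 - (y + v - v * t) with hw
    have hw0 : 0 ≤ w := by linarith
    have hc := (convex_convexHull ℝ {z : ℝ × ℝ | ∃ s ∈ S, (s.1 : ℝ) ≤ z.1 ∧ (s.2 : ℝ) ≤ z.2})
      (x := ((x : ℝ), (y : ℝ) + v + w)) (y := ((x : ℝ) + u, (y : ℝ) + w))
      (subset_convexHull ℝ _ ⟨_, h0, by simp, by push_cast; linarith⟩)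
      (subset_convexHull ℝ _ ⟨_, h1, by push_cast; simp, by simpa using hw0⟩)
      (sub_nonneg.mpr ht1) ht0 (by ring)
    convert hc using 1
    · rfl
    refine Prod.ext ?_ ?_
    · simp only [Prod.fst_add, Prod.smul_fst, smul_eq_mul]
      linear_combination -htu
    · simp only [Prod.snd_add, Prod.smul_snd, smul_eq_mul]
      linear_combination hw
  · rintro ⟨⟨hx1, hx2⟩, hz2, hlt⟩
    have hNx : (N : ℝ) ≤ x := by exact_mod_cast hN
    refine ⟨⟨⟨hNx.trans hx1, hz2⟩, fun hz => ?_⟩, hx1, hx2⟩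
    have := le_of_mem_newtonPolyhedron (p := v) (q := u) (c := v * x + u * (y + v))
      (Nat.cast_nonneg _) (Nat.cast_nonneg _) (fun s hs => by exact_mod_cast hS s hs) hz
    have h2 : (u : ℝ) * z.2 < u * (y + v - v / u * (z.1 - x)) := mul_lt_mul_of_pos_left hlt hu'
    have h3 : (u : ℝ) * (y + v - v / u * (z.1 - x)) = u * (y + v) - v * (z.1 - x) := by
      field_simp
    linarith

theorem volume_strip {x u y v : ℝ} (hu : 0 < u) (hy : 0 ≤ y) (hv : 0 ≤ v) :
    MeasurableSet {z : ℝ × ℝ | z.1 ∈ Set.Ico x (x + u) ∧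
      z.2 ∈ Set.Ico 0 (y + v - v / u * (z.1 - x))} ∧
    volume {z : ℝ × ℝ | z.1 ∈ Set.Ico x (x + u) ∧
      z.2 ∈ Set.Ico 0 (y + v - v / u * (z.1 - x))} = ENNReal.ofReal (u * (2 * y + v) / 2) := by
  set T := {z : ℝ × ℝ | z.1 ∈ Set.Ico x (x + u) ∧ z.2 ∈ Set.Ico 0 (y + v - v / u * (z.1 - x))}
  have hT : MeasurableSet T := by
    refine (measurableSet_Ico.preimage measurable_fst).inter ?_
    exact (measurableSet_le measurable_const measurable_snd).inter
      (measurableSet_lt measurable_snd (by fun_prop))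
  refine ⟨hT, ?_⟩
  have hslice : ∀ t : ℝ, volume (Prod.mk t ⁻¹' T) =
      (Set.Ico x (x + u)).indicator (fun t => ENNReal.ofReal (y + v - v / u * (t - x))) t := by
    intro t
    by_cases ht : t ∈ Set.Ico x (x + u)
    · rw [Set.indicator_of_mem ht]
      have : Prod.mk t ⁻¹' T = Set.Ico 0 (y + v - v / u * (t - x)) := by
        ext s
        exact ⟨fun h => h.2, fun h => ⟨ht, h⟩⟩
      rw [this, Real.volume_Ico, sub_zero]
    · rw [Set.indicator_of_notMem ht]
      have : Prod.mk t ⁻¹' T = ∅ := by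
        ext s
        exact ⟨fun h => absurd h.1 ht, fun h => h.elim⟩
      rw [this, measure_empty]
  rw [Measure.volume_eq_prod, Measure.prod_apply hT]
  simp only [hslice]
  rw [lintegral_indicator measurableSet_Ico, ← ofReal_integral_eq_lintegral_ofReal]
  · congr 1
    rw [integral_Ico_eq_integral_Ioc, ← intervalIntegral.integral_of_le (by linarith)]
    have hd : ∀ t ∈ Set.uIcc x (x + u), HasDerivAt
        (fun t => (y + v) * t - v / u * ((t - x) ^ 2 / 2)) (y + v - v / u * (t - x)) t := by
      intro t _
      have h1 := ((hasDerivAt_id t).const_mul (y + v)).sub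
        (((((hasDerivAt_id t).sub_const x).pow 2).div_const 2).const_mul (v / u))
      refine h1.congr_deriv ?_
      simp
    rw [intervalIntegral.integral_eq_sub_of_hasDerivAt hd
      (Continuous.intervalIntegrable (by fun_prop) _ _)]
    field_simp
    ring
  · exact (Continuous.integrableOn_Icc (by fun_prop)).mono_set Set.Ico_subset_Icc_self
  · refine (ae_restrict_iff' measurableSet_Ico).mpr (Filter.Eventually.of_forall fun t ht => ?_)
    have h1 : v / u * (t - x) ≤ v / u * u :=
      mul_le_mul_of_nonneg_left (by linarith [ht.2]) (div_nonneg hv hu.le)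
    rw [div_mul_cancel₀ _ hu.ne'] at h1
    simp only [Pi.zero_apply]
    linarith

/-- Twice the area between the Newton polygon of `S`, the lines `X = N` and `X = x`, and the
`X`-axis is `W`. -/
def HasArea (S : Set (ℕ × ℕ)) (N x W : ℕ) : Prop :=
  volume (({z : ℝ × ℝ | (N : ℝ) ≤ z.1 ∧ 0 ≤ z.2} \ newtonPolyhedron S) ∩ {z | z.1 < x}) =
    ENNReal.ofReal ((W : ℝ) / 2)

theorem hasArea_self (S : Set (ℕ × ℕ)) (N : ℕ) : HasArea S N N 0 := by
  rw [HasArea]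
  convert measure_empty (μ := (volume : Measure (ℝ × ℝ)))
  · ext z
    simp only [Set.mem_inter_iff, Set.mem_sdiff, Set.mem_ofPred_eq, Set.mem_empty_iff_false, iff_false]
    rintro ⟨⟨⟨h1, -⟩, -⟩, h2⟩
    exact absurd h1 (not_le.mpr h2)
  · simp

theorem HasArea.step {S : Set (ℕ × ℕ)} {N x W y u v : ℕ} (h : HasArea S N x W) (hN : N ≤ x)
    (hu : 0 < u) (h0 : (x, y + v) ∈ S) (h1 : (x + u, y) ∈ S)
    (hS : ∀ s ∈ S, v * x + u * (y + v) ≤ v * s.1 + u * s.2) :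
    HasArea S N (x + u) (W + u * (2 * y + v)) := by
  have hu' : (0 : ℝ) < u := by exact_mod_cast hu
  obtain ⟨hm, hvol⟩ := volume_strip (x := x) (u := u) (y := y) (v := v) hu' (Nat.cast_nonneg _)
    (Nat.cast_nonneg _)
  rw [← strip_eq hN hu h0 h1 hS] at hm hvol
  rw [HasArea] at h ⊢
  set R := {z : ℝ × ℝ | (N : ℝ) ≤ z.1 ∧ 0 ≤ z.2} \ newtonPolyhedron S
  have hunion : R ∩ {z | z.1 < ((x + u : ℕ) : ℝ)} =
      R ∩ {z | z.1 < (x : ℝ)} ∪ R ∩ {z | (x : ℝ) ≤ z.1 ∧ z.1 < x + u} := by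
    rw [← Set.inter_union_distrib_left]
    congr 1
    ext z
    simp only [Set.mem_ofPred_eq, Set.mem_union, Nat.cast_add]
    constructor
    · intro hz
      rcases lt_or_ge z.1 (x : ℝ) with h | h
      · exact Or.inl h
      · exact Or.inr ⟨h, hz⟩
    · rintro (hz | hz)
      · linarith
      · exact hz.2
  have hdis : Disjoint (R ∩ {z | z.1 < (x : ℝ)}) (R ∩ {z | (x : ℝ) ≤ z.1 ∧ z.1 < x + u}) := by
    rw [Set.disjoint_left]
    rintro z ⟨-, h1⟩ ⟨-, h2, -⟩
    exact absurd h1 (not_lt.mpr h2)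
  rw [hunion, measure_union hdis hm, h, hvol, ← ENNReal.ofReal_add (by positivity) (by positivity)]
  congr 1
  push_cast
  ring

theorem HasArea.areaFrom {S : Set (ℕ × ℕ)} {N x W : ℕ} (h : HasArea S N x W) (hx : (x, 0) ∈ S) :
    2 * areaFrom N S = W := by
  rw [HasArea] at h
  rw [NewtonTrees.areaFrom]
  have : ({z : ℝ × ℝ | (N : ℝ) ≤ z.1 ∧ 0 ≤ z.2} \ newtonPolyhedron S) ∩ {z | z.1 < (x : ℝ)} =
      {z : ℝ × ℝ | (N : ℝ) ≤ z.1 ∧ 0 ≤ z.2} \ newtonPolyhedron S := by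
    rw [Set.inter_eq_left]
    rintro z ⟨⟨-, h2⟩, hz⟩
    by_contra hlt
    exact hz (mem_newtonPolyhedron_of_le hx (not_lt.mp hlt) (by simpa using h2))
  rw [← this, h, ENNReal.toReal_ofReal (by positivity)]
  ring

/-! ### Lattice lengths and the area under a chain of edges -/

/-- The lattice length of a face of `S`. -/
def faceLen (S : Set (ℕ × ℕ)) (p q : ℕ) : ℕ := sInf {r | ∃ a b, IsFace S p q a b r}

theorem IsFace.faceLen_eq {S : Set (ℕ × ℕ)} {p q a b r : ℕ} (hq : 0 < q)
    (h : IsFace S p q a b r) : faceLen S p q = r := by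
  obtain ⟨a', b', h'⟩ := Nat.sInf_mem (s := {r | ∃ a b, IsFace S p q a b r}) ⟨r, a, b, h⟩
  exact (h'.unique hq h).2.2

theorem IsFace.weight_eq {f : Series K} {p q a b r : ℕ} (h : IsFace (supp f) p q a b r) :
    weight p q f = p * a + q * (b + p * r) :=
  le_antisymm (weight_le p q h.top_mem) (le_csInf ⟨_, _, h.top_mem, rfl⟩ fun _ ⟨z, hz, hN⟩ =>
    hN ▸ h.le z hz)

/-- The sum of the multiplicities of the edges, each taken as often as its lattice length. -/
def edgeSum (f : Series K) (es : List (ℕ × ℕ)) : ℕ :=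
  (es.map fun e => weight e.1 e.2 f * faceLen (supp f) e.1 e.2).sum

/-- One edge contributes the trapezoid `q r (2 b + p r)`, and `q r (2 b + p r) + x (b + p r) = N r +
(x + q r) b` for its multiplicity `N`; the products of coordinates telescope. The larger set `S`
leaves room for the end points of replaced edges. -/
theorem EdgeChain.hasArea {f : Series K} {S : Set (ℕ × ℕ)} (hfS : supp f ⊆ S)
    (hS : ∀ p q a b r, 0 < p → 0 < q → 0 < r → IsFace (supp f) p q a b r →
      ∀ s ∈ S, p * a + q * (b + p * r) ≤ p * s.1 + q * s.2)
    {x y x' y' : ℕ} {es : List (ℕ × ℕ)} (h : EdgeChain (supp f) x y es x' y') {N W : ℕ}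
    (hN : N ≤ x) (hW : HasArea S N x W) :
    ∃ A, HasArea S N x' (W + A) ∧ A + x * y = edgeSum f es + x' * y' := by
  induction h generalizing W with
  | nil x y => exact ⟨0, hW, by simp [edgeSum]⟩
  | @cons x b p q r x' y' es hp hq hr hface htail ih =>
    have h1 := hW.step (y := b) (u := q * r) (v := p * r) hN (Nat.mul_pos hq hr)
      (hfS hface.top_mem) (hfS hface.bot_mem) (fun s hs => by
        have := Nat.mul_le_mul_right r (hS p q x b r hp hq hr hface s hs)
        calc p * r * x + q * r * (b + p * r) = (p * x + q * (b + p * r)) * r := by ring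
          _ ≤ (p * s.1 + q * s.2) * r := this
          _ = _ := by ring)
    obtain ⟨A, hA, he⟩ := ih (by omega) h1
    refine ⟨q * r * (2 * b + p * r) + A, by rwa [← add_assoc], ?_⟩
    simp only [edgeSum, List.map_cons, List.sum_cons] at he ⊢
    rw [hface.weight_eq, hface.faceLen_eq hq]
    linarith

end Area

/-! ### Traces on the axes -/

/-- The lowest row of `S` is `Y = y`, and its leftmost point is `(x, y)`. -/
structure IsEnd (S : Set (ℕ × ℕ)) (x y : ℕ) : Prop where
  mem : (x, y) ∈ S
  le_snd : ∀ z ∈ S, y ≤ z.2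
  le_fst : ∀ z ∈ S, z.2 = y → x ≤ z.1

theorem IsEnd.exists_isXTrace {S : Set (ℕ × ℕ)} {x y : ℕ} (h : IsEnd S x y) (hy : y ≤ 1) :
    ∃ n, IsXTrace S n := by
  rcases Nat.le_one_iff_eq_zero_or_eq_one.mp hy with rfl | rfl
  · exact ⟨x, Or.inl ⟨h.mem, fun k hk => h.le_fst (k, 0) hk rfl⟩⟩
  -- With `n = 2 x + 1` the line meets the row `Y = 2` left of the `Y`-axis, so rows from `2` on
  -- impose no condition.
  · refine ⟨2 * x + 1, Or.inr ⟨fun k hk => absurd (h.le_snd _ hk) (by simp), x,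
      ⟨h.mem, fun k hk => h.le_fst (k, 1) hk rfl⟩, by omega, fun z hz => ?_⟩⟩
    rw [show 2 * x + 1 - x = x + 1 by omega]
    rcases (h.le_snd z hz).eq_or_lt with h1 | h1
    · have := h.le_fst z hz h1.symm
      rw [← h1]
      omega
    · have := Nat.mul_le_mul_left (x + 1) h1
      omega

theorem IsEnd.of_isXTrace {S : Set (ℕ × ℕ)} {x y n : ℕ} (h : IsEnd S x y) (hy : y ≤ 1)
    (ht : IsXTrace S n) :
    (y = 0 ∧ n = x) ∨ (y = 1 ∧ x < n ∧ ∀ z ∈ S, n ≤ z.1 + (n - x) * z.2) := by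
  rcases ht with ht | ⟨ht, c, hc, hcn, hz⟩
  · have h0 : y = 0 := Nat.le_zero.mp (h.le_snd _ ht.1)
    subst h0
    exact Or.inl ⟨rfl, le_antisymm (ht.2 h.mem) (h.le_fst (n, 0) ht.1 rfl)⟩
  · have h1 : y = 1 := by
      rcases Nat.le_one_iff_eq_zero_or_eq_one.mp hy with rfl | rfl
      · exact absurd h.mem (ht x)
      · rfl
    subst h1
    obtain rfl : c = x := le_antisymm (hc.2 h.mem) (h.le_fst (c, 1) hc.1 rfl)
    exact Or.inr ⟨rfl, hcn, hz⟩

/-- The replaced horizontal edge lies above the lines of the other edges. -/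
theorem IsEnd.le_of_isFace {S : Set (ℕ × ℕ)} {x n p q a b r : ℕ} (h : IsEnd S x 1) (hxn : x < n)
    (hS : ∀ z ∈ S, n ≤ z.1 + (n - x) * z.2) (hp : 0 < p) (hr : 0 < r)
    (hface : IsFace S p q a b r) : p * a + q * (b + p * r) ≤ p * n := by
  obtain ⟨m, rfl⟩ := Nat.exists_eq_add_of_lt hxn
  have hb : 1 ≤ b := h.le_snd _ hface.bot_mem
  have hpr := Nat.mul_pos hp hr
  have h1 := hS _ hface.top_mem
  have h2 := hface.le _ h.mem
  obtain ⟨Y, hY⟩ : ∃ Y, b + p * r = Y + 2 := ⟨b + p * r - 2, by omega⟩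
  rw [show x + m + 1 - x = m + 1 by omega] at h1
  simp only [hY] at h1 h2 ⊢
  have h3 := Nat.mul_le_mul_left p h1
  have h4 := Nat.mul_le_mul_left (Y + 2) h2
  -- The row `Y = 1` divides the segment from the top of the face, at height `Y + 2`, to `(n, 0)` in
  -- the ratio `Y + 1` to `1`; the factors are these barycentric weights.
  refine Nat.le_of_mul_le_mul_right (c := Y + 1) ?_ (Nat.succ_pos Y)
  nlinarith

theorem IsFace.swap {S : Set (ℕ × ℕ)} {p q a b r : ℕ} (h : IsFace S p q a b r) (hq : 0 < q) :
    IsFace (Prod.swap ⁻¹' S) q p b a r := by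
  have e : q * b + p * (a + q * r) = p * a + q * (b + p * r) := by ring
  refine ⟨h.bot_mem, h.top_mem, fun z hz => ?_, fun z hz he => ?_⟩
  · have := h.le _ hz
    simp only [Prod.fst_swap, Prod.snd_swap] at this
    rw [e]
    omega
  · have h1 := h.mem_Icc _ hz
    simp only [Prod.fst_swap, Prod.snd_swap] at h1
    rw [e] at he
    obtain ⟨h2, h3⟩ := h1 (by omega)
    have h4 := Nat.mul_le_mul_left p h2
    have h5 := Nat.mul_le_mul_left p h3
    constructor
    · exact Nat.le_of_mul_le_mul_left (by linarith : q * b ≤ q * z.1) hq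
    · exact Nat.le_of_mul_le_mul_left (by linarith : q * z.1 ≤ q * (b + p * r)) hq

theorem HasForm.isEnd_swap {f : Series K} {N e : ℕ} (h : HasForm f N e) :
    IsEnd (Prod.swap ⁻¹' supp f) e N := by
  obtain ⟨h1, h2, h3⟩ := hasForm_iff.mp h
  refine ⟨h3, fun z hz => not_lt.mp fun hl => hz (h1 _ _ hl), fun z hz he => not_lt.mp fun hl => ?_⟩
  apply hz
  simp only [Prod.fst_swap, Prod.snd_swap, he]
  exact h2 _ hl

/-! ### The area of a Newton polygon in terms of its edges -/

/-- A replaced last edge adds a triangle of doubled area `n - x'`, which turns the boundary term `x'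
* 1` into `n`. -/
theorem EdgeChain.areaFrom {f : Series K} {S : Set (ℕ × ℕ)} (hfS : supp f ⊆ S)
    (hS : ∀ p q a b r, 0 < p → 0 < q → 0 < r → IsFace (supp f) p q a b r →
      ∀ s ∈ S, p * a + q * (b + p * r) ≤ p * s.1 + q * s.2)
    {x y x' y' n : ℕ} {es : List (ℕ × ℕ)} (h : EdgeChain (supp f) x y es x' y')
    (hx : (x', y') ∈ supp f) (hn : (n, 0) ∈ S)
    (htr : (y' = 0 ∧ n = x') ∨ (y' = 1 ∧ x' < n ∧ ∀ z ∈ S, n ≤ z.1 + (n - x') * z.2))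
    {N W : ℕ} (hN : N ≤ x) (hxx : N ≤ x') (hW : HasArea S N x W) :
    2 * areaFrom N S + x * y = W + edgeSum f es + if y' = 0 then (0 : ℝ) else n := by
  obtain ⟨A, hA, he⟩ := h.hasArea hfS hS hN hW
  rcases htr with ⟨rfl, rfl⟩ | ⟨rfl, hlt, hz⟩
  · rw [hA.areaFrom hn, if_pos rfl]
    rw [mul_zero, add_zero] at he
    rw [← he]
    push_cast
    ring
  · obtain ⟨m, rfl⟩ := Nat.exists_eq_add_of_lt hlt
    have h1 := hA.step (y := 0) (u := m + 1) (v := 1) hxx (Nat.succ_pos m) (hfS hx) hn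
      (fun s hs => by
        have := hz s hs
        rw [show x' + m + 1 - x' = m + 1 by omega] at this
        omega)
    rw [h1.areaFrom hn, if_neg one_ne_zero]
    have he' : (A : ℝ) + x * y = edgeSum f es + x' * 1 := by exact_mod_cast he
    push_cast
    linarith

theorem HasForm.two_mul_areaFrom {f : Series K} {N e x' n : ℕ} {es : List (ℕ × ℕ)}
    (hf : HasForm f N e) (h : EdgeChain (supp f) N e es x' (ordY f))
    (hend : IsEnd (supp f) x' (ordY f)) (hy : ordY f ≤ 1) (hn : IsXTrace (supp f) n) :
    2 * areaFrom N (supp f ∪ {(n, 0)}) + N * e =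
      edgeSum f es + if ordY f = 0 then (0 : ℝ) else n := by
  have htr := hend.of_isXTrace hy hn
  have hN : ∀ z ∈ supp f, N ≤ z.1 := fun z hz => hf.isEnd_swap.le_snd z.swap hz
  have := h.areaFrom (S := supp f ∪ {(n, 0)}) Set.subset_union_left
    (fun p q a b r hp hq hr hface s hs => by
      rcases hs with hs | rfl
      · exact hface.le s hs
      · rcases htr with ⟨h0, rfl⟩ | ⟨h1, h2, h3⟩
        · exact hface.le _ (h0 ▸ hend.mem)
        · rw [h1] at hend
          simpa using hend.le_of_isFace h2 h3 hp hr hface)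
    hend.mem (Or.inr rfl) (htr.imp id fun ⟨h1, h2, h3⟩ => ⟨h1, h2, fun z hz => by
      rcases hz with hz | rfl
      · exact h3 z hz
      · simp⟩) le_rfl (hN _ hend.mem) (hasArea_self _ N)
  rw [this]
  simp

/-- If `x` divides `f`, the replaced edge from `(0, b)` to `(1, e)` adds the doubled area `b + e`;
the term `N * e` cancels `e` and leaves `b`. -/
theorem HasForm.two_mul_areaFrom_zero {f : Series K} {N e x' a b : ℕ} {es : List (ℕ × ℕ)}
    (hf : HasForm f N e) (hN1 : N ≤ 1) (h : EdgeChain (supp f) N e es x' (ordY f))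
    (hend : IsEnd (supp f) x' (ordY f)) (hy : ordY f ≤ 1) (ha : IsXTrace (supp f) a)
    (hb : IsYTrace (supp f) b) :
    2 * areaFrom 0 (supp f ∪ {(a, 0), (0, b)}) =
      edgeSum f es + (if ordY f = 0 then (0 : ℝ) else a) + if N = 0 then (0 : ℝ) else b := by
  have htr := hend.of_isXTrace hy ha
  have htr' := hf.isEnd_swap.of_isXTrace hN1 hb
  have hswap := hf.isEnd_swap
  -- If `(1, e)` is on or above the line through `(c, 1)` and `(n, 0)`, so is `(0, b)` for `b > e`:
  -- the two added points do not interfere.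
  have hab : ∀ c n e b : ℕ, e < b → n ≤ 1 + (n - c) * e → c < n → n ≤ (n - c) * b := by
    intro c n e b h1 h2 h3
    have h4 := Nat.mul_le_mul_left (n - c) h1
    rw [Nat.mul_succ] at h4
    omega
  have hS : ∀ p q a' b' r, 0 < p → 0 < q → 0 < r → IsFace (supp f) p q a' b' r →
      ∀ s ∈ supp f ∪ {(a, 0), (0, b)}, p * a' + q * (b' + p * r) ≤ p * s.1 + q * s.2 := by
    intro p q a' b' r hp hq hr hface s hs
    rcases hs with hs | rfl | rfl
    · exact hface.le s hs
    · rcases htr with ⟨h0, rfl⟩ | ⟨h1, h2, h3⟩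
      · exact hface.le _ (h0 ▸ hend.mem)
      · rw [h1] at hend
        simpa using hend.le_of_isFace h2 h3 hp hr hface
    · rcases htr' with ⟨h0, rfl⟩ | ⟨h1, h2, h3⟩
      · exact hface.le _ (h0 ▸ hswap.mem)
      · rw [h1] at hswap
        have := hswap.le_of_isFace h2 h3 hq hr (hface.swap hq)
        simp only [mul_zero, zero_add]
        calc p * a' + q * (b' + p * r) = q * b' + p * (a' + q * r) := by ring
          _ ≤ q * b := this
  have htr2 : (ordY f = 0 ∧ a = x') ∨ (ordY f = 1 ∧ x' < a ∧
      ∀ z ∈ supp f ∪ {(a, 0), (0, b)}, a ≤ z.1 + (a - x') * z.2) := by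
    refine htr.imp id fun ⟨h1, h2, h3⟩ => ⟨h1, h2, fun z hz => ?_⟩
    rcases hz with hz | rfl | rfl
    · exact h3 z hz
    · simp
    · simp only [zero_add]
      rcases htr' with ⟨h4, rfl⟩ | ⟨h4, h5, h6⟩
      · simpa [h4] using h3 _ (show (N, b) ∈ supp f from hswap.mem)
      · have h7 := h3 _ (show (N, e) ∈ supp f from hswap.mem)
        have h8 := h6 (ordY f, x') hend.mem
        have h9 : 1 ≤ x' := by
          have := hswap.le_snd (ordY f, x') hend.mem
          simpa [h4] using this
        exact hab x' a e b h5 (by simp only [h4] at h7; omega) h2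
  rcases htr' with ⟨rfl, rfl⟩ | ⟨rfl, h2, h3⟩
  · have := h.areaFrom (S := supp f ∪ {(a, 0), (0, b)}) Set.subset_union_left hS hend.mem
      (Or.inr (Or.inl rfl)) htr2 le_rfl (Nat.zero_le _) (hasArea_self _ 0)
    simpa using this
  · obtain ⟨m, rfl⟩ := Nat.exists_eq_add_of_lt h2
    have hx1 : 1 ≤ x' := hswap.le_snd (ordY f, x') hend.mem
    have hW := (hasArea_self (supp f ∪ {(a, 0), (0, e + m + 1)}) 0).step (y := e) (u := 1)
      (v := m + 1) le_rfl one_pos (Or.inr (Or.inr rfl)) (Or.inl hswap.mem) (fun s hs => by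
        rw [mul_zero, zero_add, one_mul, one_mul]
        rcases hs with hs | rfl | rfl
        · have := h3 s.swap hs
          simp only [Prod.fst_swap, Prod.snd_swap] at this
          rw [show e + m + 1 - e = m + 1 by omega] at this
          omega
        · simp only [add_zero]
          rcases htr with ⟨h4, rfl⟩ | ⟨h4, h5, h6⟩
          · have := h3 (ordY f, a) hend.mem
            rw [show e + m + 1 - e = m + 1 by omega, h4] at this
            simp only at this
            omega
          · have h7 := h3 (ordY f, x') hend.mem
            rw [h4] at h7
            have h8 := h6 _ (show (1, e) ∈ supp f from hswap.mem)
            have h9 := hab e (e + m + 1) x' a h5 (by simp only at h7; omega) h2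
            rw [show e + m + 1 - e = m + 1 by omega] at h9
            omega
        · simp; omega)
    have := h.areaFrom (S := supp f ∪ {(a, 0), (0, e + m + 1)}) Set.subset_union_left hS hend.mem
      (Or.inr (Or.inl rfl)) htr2 (Nat.zero_le _) (Nat.zero_le _) hW
    rw [if_neg one_ne_zero]
    push_cast at this ⊢
    linarith

/-! ### The sum over a Newton tree -/

theorem HasForm.exists_edgeChain {f : Series K} {N e : ℕ} (h : HasForm f N e)
    {es : List (ℕ × ℕ)} (hes : IsEdgeList f es) :
    ∃ x', EdgeChain (supp f) N e es x' (ordY f) ∧ IsEnd (supp f) x' (ordY f) := by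
  obtain ⟨x', h1, h2, h3⟩ := h.edgeChain hes
  exact ⟨x', h1, h2, fun z hz => (h3 z hz).1, fun z hz => (h3 z hz).2⟩

theorem X1_pow_ordY_dvd (f : Series K) : X 1 ^ ordY f ∣ f := by
  rw [X1_pow_dvd_iff]
  intro i j hj
  by_contra h
  exact absurd (Nat.sInf_le ⟨i, h⟩ : ordY f ≤ j) (not_le.mpr hj)

theorem LogReducedX.ordY_le_one {f : Series K} (h : LogReducedX f) : ordY f ≤ 1 := by
  by_contra hy
  obtain ⟨m, hm⟩ := h.dvd_of_sq_dvd ((pow_dvd_pow _ (not_le.mp hy)).trans (X1_pow_ordY_dvd f))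
  exact hasForm_X1.not_dvd_X0_pow one_pos m hm

/-- The transforms made at the multiple roots of a face polynomial. -/
theorem IsFaceFactorization.transform {p q : ℕ} {f : Series K} (hf : LogReduced f) {n : ℕ}
    {μ : Fin n → K} {ν : Fin n → ℕ} (he : IsEdge f (p, q)) (h : IsFaceFactorization p q f μ ν)
    (j : Fin n) :
    HasForm (hnTransform p q (μ j) f) (weight p q f) (ν j) ∧
      LogReducedX (hnTransform p q (μ j) f) := by
  classical
  refine ⟨?_, hf.hnTransform he.1 he.2.1 he.2.2.1 (h.2.1 j)⟩
  have := h.hasForm_hnTransform he.1 he.2.1 he.2.2.1 (h.2.1 j)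
  simpa [h.1.eq_iff] using this

theorem EdgeChain.nil_eq {S : Set (ℕ × ℕ)} {x y x' y' : ℕ} (h : EdgeChain S x y [] x' y') :
    x = x' ∧ y = y' := by
  cases h
  exact ⟨rfl, rfl⟩

theorem IsChain.deadEndTerm_eq {D : ℕ} {g : Series K} {es : List (ℕ × ℕ)} {t : Subtree}
    {L : Multiset (ℕ × Series K)} (h : IsChain D g es t L) (N a : ℕ) :
    deadEndTerm N a t = if es = [] ∧ ordY g = 0 then -((N : ℚ) / a) else 0 := by
  cases h with
  | nil =>
    rcases Nat.eq_zero_or_pos (ordY g) with h0 | h0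
    · simp [h0, deadEndTerm]
      ring
    · obtain ⟨k, hk⟩ := Nat.exists_eq_succ_of_ne_zero h0.ne'
      simp [hk, deadEndTerm]
  | cons => simp [deadEndTerm]

/-- The summand of a Hamburger–Noether transform in the area formula. -/
def areaTerm (n : ℕ × Series K → ℕ) (ℓ : ℕ × Series K) : ℝ :=
  2 * areaFrom ℓ.1 (supp ℓ.2 ∪ {(n ℓ, 0)}) - ((n ℓ : ℝ) - ℓ.1)

theorem sum_map_areaTerm (n : ℕ × Series K → ℕ) {m : ℕ} (L : Multiset (ℕ × Series K))
    (F : Fin m → Multiset (ℕ × Series K)) :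
    ((L + ∑ j, F j).map (areaTerm n)).sum =
      (L.map (areaTerm n)).sum + ∑ j, ((F j).map (areaTerm n)).sum := by
  rw [Multiset.map_add, Multiset.sum_add]
  congr 1
  exact map_sum (Multiset.sumAddMonoidHom.comp (Multiset.mapAddMonoidHom (areaTerm n))) F _

/-- By reducedness `Y ^ 2` divides no transform, so each polygon ends on the row `Y = 0` or `Y = 1`.
-/
theorem IsChain.exists_isXTrace {D : ℕ} {g : Series K} {es : List (ℕ × ℕ)} {t : Subtree}
    {L : Multiset (ℕ × Series K)} (h : IsChain D g es t L) (hg : LogReduced g)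
    (hes : ∀ e ∈ es, IsEdge g e) : ∀ ℓ ∈ L, ∃ n, IsXTrace (supp ℓ.2) n := by
  induction h with
  | nil => simp
  | cons D g p q es n μ ν right below es' L' L hface hone hedges hglue hbelow ih ihb =>
    intro ℓ hℓ
    rcases Multiset.mem_add.mp hℓ with hℓ | hℓ
    · exact ihb hg (fun e he => hes e (List.mem_cons_of_mem _ he)) ℓ hℓ
    · obtain ⟨j, -, hj⟩ := Multiset.mem_sum.mp hℓ
      split_ifs at hj with hν
      · obtain ⟨hform, hred⟩ := hface.transform hg (hes _ List.mem_cons_self) j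
        rcases Multiset.mem_cons.mp hj with rfl | hj
        · obtain ⟨x', -, hend⟩ := hform.exists_edgeChain (hedges j hν)
          exact hend.exists_isXTrace hred.ordY_le_one
        · exact ih j hν hred.logReduced (fun e he => ((hedges j hν).1 e).mp he) ℓ hj
      · simp at hj

/-- At a vertex, `N * n + ∑ N * (νⱼ - 1) = N * r`. The case `es = []` is set apart because a bottom
arrowhead is counted with the vertex above it, hence not in its own `sum`. -/
theorem IsChain.sum_eq {D : ℕ} {g : Series K} {es : List (ℕ × ℕ)} {t : Subtree}
    {L : Multiset (ℕ × Series K)} (h : IsChain D g es t L) (hg : LogReduced g)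
    (hes : ∀ e ∈ es, IsEdge g e) {x y x' : ℕ} (hc : EdgeChain (supp g) x y es x' (ordY g))
    {n : ℕ × Series K → ℕ} (hn : ∀ ℓ ∈ L, IsXTrace (supp ℓ.2) (n ℓ)) :
    (t.sum : ℝ) = edgeSum g es - (if es ≠ [] ∧ ordY g = 0 then (x' : ℝ) else 0) +
      (L.map (areaTerm n)).sum := by
  induction h generalizing x y x' with
  | nil => simp [Subtree.sum, edgeSum]
  | cons D g p q es m μ ν right below es' L' L hface hone hedges hglue hbelow ih ihb =>
    have hedge := hes _ List.mem_cons_self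
    have hes' : ∀ e ∈ es, IsEdge g e := fun e he => hes e (List.mem_cons_of_mem _ he)
    have hp0 : (p : ℚ) ≠ 0 := Nat.cast_ne_zero.mpr hedge.1.ne'
    obtain ⟨hp, hq, b, r, -, hf, htail⟩ : ∃ (_ : 0 < p) (_ : 0 < q), ∃ b r, ∃ (_ : y = b + p * r),
        IsFace (supp g) p q x b r ∧ EdgeChain (supp g) (x + q * r) b es x' (ordY g) := by
      cases hc with
      | cons hp hq hr hf ht => exact ⟨hp, hq, _, _, rfl, hf, ht⟩
    have hnL : ∀ ℓ ∈ L, IsXTrace (supp ℓ.2) (n ℓ) := fun ℓ hℓ => hn ℓ (Multiset.mem_add.mpr (Or.inl hℓ))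
    have hnj : ∀ j, 1 < ν j → ∀ ℓ ∈ (weight p q g, hnTransform p q (μ j) g) ::ₘ L' j,
        IsXTrace (supp ℓ.2) (n ℓ) := fun j hj ℓ hℓ =>
      hn ℓ (Multiset.mem_add.mpr (Or.inr (Multiset.mem_sum.mpr ⟨j, Finset.mem_univ j, by
        rwa [if_pos hj]⟩)))
    have hrν : ∑ j, ν j = r := by
      obtain ⟨-, hμ, -, c, a, b, hc0, hfac⟩ := hface
      exact ((IsFaceFactorization.isFace hq hμ hc0 hfac).1.unique hq hf).2.2
    have hright : ∀ j, ((deadEndTerm (weight p q g) 1 (right j) + (right j).sum : ℚ) : ℝ) =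
        weight p q g * ((ν j : ℝ) - 1) +
          ((if 1 < ν j then (weight p q g, hnTransform p q (μ j) g) ::ₘ L' j else 0).map
            (areaTerm n)).sum := by
      intro j
      rcases (Nat.succ_le_of_lt (hface.2.2.1 j)).eq_or_lt with h1 | h1
      · rw [hone j h1.symm, if_neg (by omega), ← h1]
        simp [deadEndTerm, Subtree.sum]
      · obtain ⟨hform, hred⟩ := hface.transform hg hedge j
        obtain ⟨x1, hch, hend⟩ := hform.exists_edgeChain (hedges j h1)
        have hy1 := hred.ordY_le_one
        -- Without edges the polygon would be the single vertex `(N, νⱼ)`, and `Y ^ νⱼ` with `νⱼ >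
        -- 1` would divide the transform. So no dead end is attached to the right.
        have hne : es' j ≠ [] := by
          intro h0
          rw [h0] at hch
          have : ordY (hnTransform p q (μ j) g) = ν j := hch.nil_eq.2.symm
          omega
        have htrace := hnj j h1 _ (Multiset.mem_cons_self _ _)
        have harea := hform.two_mul_areaFrom hch hend hy1 htrace
        have hsum := ih j h1 hred.logReduced (fun e he => ((hedges j h1).1 e).mp he) hch
          (fun ℓ hℓ => hnj j h1 ℓ (Multiset.mem_cons_of_mem hℓ))
        rw [(hglue j h1).deadEndTerm_eq, if_neg (by simp [hne]), zero_add, hsum, if_pos h1,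
          Multiset.map_cons, Multiset.sum_cons, areaTerm]
        rcases hend.of_isXTrace hy1 htrace with ⟨h2, h3⟩ | ⟨h2, h3, -⟩
        · rw [if_pos ⟨hne, h2⟩, ← h3]
          rw [if_pos h2] at harea
          simp only
          linarith
        · rw [if_neg (by simp [h2])]
          rw [if_neg (by simp [h2])] at harea
          simp only
          linarith
    have hdead : ((deadEndTerm (weight p q g) p below : ℚ) : ℝ) =
        -if es = [] ∧ ordY g = 0 then (x' : ℝ) else 0 := by
      rw [hbelow.deadEndTerm_eq]
      split_ifs with h0
      · obtain ⟨rfl, h0⟩ := h0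
        obtain ⟨hx', hb⟩ := htail.nil_eq
        rw [h0] at hb
        -- The last edge ends at `(x', 0)`, so its multiplicity divided by `p` is `x'`.
        have hw : (weight p q g : ℚ) = p * ((x + q * r : ℕ) : ℚ) := by
          rw [hf.weight_eq, hb]
          push_cast
          ring
        rw [← hx', hw, mul_div_cancel_left₀ _ hp0]
        push_cast
        rfl
      · simp
    have hbsum := ihb hg hes' htail hnL
    rw [sum_map_areaTerm]
    have hesum : (edgeSum g ((p, q) :: es) : ℝ) = weight p q g * (r : ℝ) + edgeSum g es := by
      have : edgeSum g ((p, q) :: es) = weight p q g * r + edgeSum g es := by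
        rw [edgeSum, List.map_cons, List.sum_cons, hf.faceLen_eq hq]
        rfl
      exact_mod_cast this
    have hrsum : (∑ j, ((ν j : ℝ) - 1)) = r - m := by
      rw [Finset.sum_sub_distrib, ← hrν]
      simp
    have hright' := Finset.sum_congr (rfl : (Finset.univ : Finset (Fin m)) = _)
      fun j _ => hright j
    rw [Finset.sum_add_distrib, ← Finset.mul_sum, hrsum, ← Rat.cast_sum] at hright'
    have htot : ((Subtree.vertex (weight p q g) p (q + D * p) m right below).sum : ℝ) =
        weight p q g * (m : ℝ) + ((deadEndTerm (weight p q g) p below : ℚ) : ℝ) + (below.sum : ℝ) +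
          ((∑ j, (deadEndTerm (weight p q g) 1 (right j) + (right j).sum) : ℚ) : ℝ) := by
      rw [Subtree.sum]
      push_cast
      ring
    rw [htot, hdead, hbsum, hright', hesum]
    by_cases h0 : ordY g = 0 <;> by_cases h1 : es = [] <;> simp [h0, h1] <;> ring

/-! ### Existence of Newton trees -/

/-- One polygon, assuming the trees of its transforms. It serves both the well-founded recursion and
the first series, to which `IsStep` does not apply because only `LogReduced` is known for it. -/
theorem exists_isChain_of_transform [IsAlgClosed K] {g : Series K} (hg : LogReduced g)
    (hg0 : g ≠ 0)
    (H : ∀ (p q : ℕ) (m : K), 0 < p → 0 < q → Nat.Coprime p q → m ≠ 0 →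
      (∃ N e, 2 ≤ e ∧ HasForm (hnTransform p q m g) N e) → ∀ (D : ℕ) (es : List (ℕ × ℕ)),
        IsEdgeList (hnTransform p q m g) es → ∃ t L, IsChain D (hnTransform p q m g) es t L)
    (D : ℕ) {es : List (ℕ × ℕ)} (hes : ∀ e ∈ es, IsEdge g e) : ∃ t L, IsChain D g es t L := by
  induction es with
  | nil => exact ⟨_, _, .nil D g⟩
  | cons e es ih =>
    obtain ⟨below, L, hbelow⟩ := ih fun e he => hes e (List.mem_cons_of_mem _ he)
    obtain ⟨p, q⟩ := e
    have he := hes _ List.mem_cons_self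
    obtain ⟨n, μ, ν, hface⟩ := exists_isFaceFactorization hg0 he.1 he.2.1 he.2.2.1
    have hj : ∀ j, ∃ (right : Subtree) (es' : List (ℕ × ℕ)) (L' : Multiset (ℕ × Series K)),
        (ν j = 1 → right = .arrow 1) ∧ (1 < ν j → IsEdgeList (hnTransform p q (μ j) g) es') ∧
        (1 < ν j → IsChain (p * (q + D * p)) (hnTransform p q (μ j) g) es' right L') := by
      intro j
      by_cases h1 : 1 < ν j
      · have hform := (hface.transform hg he j).1
        obtain ⟨es', hes'⟩ := hform.exists_isEdgeList
        obtain ⟨t, L', ht⟩ := H p q (μ j) he.1 he.2.1 he.2.2.1 (hface.2.1 j) ⟨_, _, h1, hform⟩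
          (p * (q + D * p)) es' hes'
        exact ⟨t, es', L', fun h => absurd h h1.ne', fun _ => hes', fun _ => ht⟩
      · exact ⟨.arrow 1, [], 0, fun _ => rfl, fun h => absurd h h1, fun h => absurd h h1⟩
    choose right es' L' h1 h2 h3 using hj
    exact ⟨_, _, .cons D g p q es n μ ν right below es' L' L hface h1 h2 h3 hbelow⟩

theorem LogReducedX.exists_isChain [IsAlgClosed K] {g : Series K} (hg : LogReducedX g) (hg0 : g ≠ 0)
    (D : ℕ) {es : List (ℕ × ℕ)} (hes : ∀ e ∈ es, IsEdge g e) : ∃ t L, IsChain D g es t L := by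
  refine isStep_wellFounded.induction (C := fun g => LogReducedX g → g ≠ 0 →
    ∀ (D : ℕ) (es : List (ℕ × ℕ)), (∀ e ∈ es, IsEdge g e) → ∃ t L, IsChain D g es t L) g
    (fun g ih hg hg0 D es hes => ?_) hg hg0 D es hes
  refine exists_isChain_of_transform hg.logReduced hg0
    (fun p q m hp hq hpq hm hform D es' hes' => ?_) D hes
  refine ih _ ⟨hg, ⟨p, q, m, hp, hq, hpq, hm, rfl⟩, hform⟩
    (hg.logReduced.hnTransform hp hq hpq hm) ?_ D es' fun e he => (hes'.1 e).mp he
  obtain ⟨N, e, -, h⟩ := hform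
  exact h.ne_zero

theorem exists_isNewtonTree [IsAlgClosed K] {f : Series K} (hf : LogReduced f) (hf0 : f ≠ 0) :
    ∃ T L, IsNewtonTree f T L := by
  obtain ⟨N, e, hform⟩ := exists_hasForm hf0
  obtain ⟨es, hes⟩ := hform.exists_isEdgeList
  obtain ⟨t, L, h⟩ := exists_isChain_of_transform hf hf0
    (fun p q m hp hq hpq hm ⟨N, e, _, h⟩ D es' hes' =>
      (hf.hnTransform hp hq hpq hm).exists_isChain h.ne_zero D fun e he => (hes'.1 e).mp he) 0
    fun e he => (hes.1 e).mp he
  exact ⟨⟨ordX f, t⟩, L, es, hes, rfl, h⟩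

/-! ### The area formula -/

/-- For `N = 0` the first edge starts at `(0, e)`, so its multiplicity divided by `q` is `e`. -/
theorem IsChain.topTerm_eq {g : Series K} {es : List (ℕ × ℕ)} {T : NewtonTree}
    {L : Multiset (ℕ × Series K)} (h : IsChain 0 g es T.body L) {N e x' : ℕ}
    (hc : EdgeChain (supp g) N e es x' (ordY g)) (hT : T.top = N) :
    (T.topTerm : ℝ) = -if es ≠ [] ∧ N = 0 then (e : ℝ) else 0 := by
  obtain ⟨top, body⟩ := T
  simp only at h hT
  subst hT
  cases hc with
  | nil =>
    cases h
    simp [NewtonTree.topTerm]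
  | @cons _ b p q r _ _ es hp hq hr hface htail =>
    cases h with
    | cons D g p q es n μ ν right below es' L' L =>
      rcases Nat.eq_zero_or_pos top with rfl | h0
      · have hq0 : (q : ℝ) ≠ 0 := Nat.cast_ne_zero.mpr hq.ne'
        have hw : (weight p q g : ℝ) = q * ((b + p * r : ℕ) : ℝ) := by
          rw [hface.weight_eq]; push_cast; ring
        simp only [NewtonTree.topTerm, deadEndTerm]
        push_cast
        rw [hw]
        simp only [ne_eq, reduceCtorEq, not_false_eq_true, and_self, if_true]
        push_cast
        field_simp
        ring
      · obtain ⟨k, rfl⟩ := Nat.exists_eq_succ_of_ne_zero h0.ne'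
        simp [NewtonTree.topTerm, deadEndTerm]

theorem hasForm_le_one_of_squarefree {f : Series K} (hf : Squarefree f) {N e : ℕ}
    (h : HasForm f N e) : N ≤ 1 ∧ ordY f ≤ 1 := by
  have hX : ∀ i : Fin 2, ¬ IsUnit (X i : Series K) := by
    intro i hi
    rw [isUnit_iff_cf, cf_zero_zero, constantCoeff_X] at hi
    exact hi rfl
  constructor
  · by_contra hN
    refine hX 0 (hf _ ?_)
    rw [← sq]
    exact (pow_dvd_pow _ (not_le.mp hN)).trans h.dvd
  · by_contra hN
    refine hX 1 (hf _ ?_)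
    rw [← sq]
    exact (pow_dvd_pow _ (not_le.mp hN)).trans (X1_pow_ordY_dvd f)

theorem associated_X1_of_ordY {f : Series K} (hf : HasForm f 0 1) (hy : ordY f = 1) :
    Associated f (X 1) := by
  obtain ⟨u, hu⟩ := X1_pow_ordY_dvd f
  rw [hy, pow_one] at hu
  subst hu
  have h := (hasForm_X1.of_mul_left hf).2.2
  exact (associated_mul_unit_left _ _ h.isUnit)

theorem associated_X0_of_hasForm {f : Series K} (hf : HasForm f 1 0) : Associated f (X 0) := by
  obtain ⟨u, hu⟩ := hf.dvd
  subst hu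
  have h := ((hasForm_X0_pow 1).of_mul_left hf).2.2
  rw [pow_one]
  exact (associated_mul_unit_left _ _ h.isUnit)

end NewtonTrees

end

/-! ### The main theorem -/

theorem mainTheorem2 {K : Type*} [Field K] [IsAlgClosed K] (f : NewtonTrees.Series K)
    (hf : Squarefree f)
    (hx : ¬ Associated f (MvPowerSeries.X 0)) (hy : ¬ Associated f (MvPowerSeries.X 1)) :
    (∃ T L, NewtonTrees.IsNewtonTree f T L) ∧
    ∀ (T : NewtonTrees.NewtonTree) (L : Multiset (ℕ × NewtonTrees.Series K)),
      NewtonTrees.IsNewtonTree f T L →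
      (∃ a, NewtonTrees.IsXTrace (NewtonTrees.supp f) a) ∧
      (∃ b, NewtonTrees.IsYTrace (NewtonTrees.supp f) b) ∧
      (∀ ℓ ∈ L, ∃ n, NewtonTrees.IsXTrace (NewtonTrees.supp ℓ.2) n) ∧
      ∀ (a b : ℕ) (n : ℕ × NewtonTrees.Series K → ℕ),
        NewtonTrees.IsXTrace (NewtonTrees.supp f) a →
        NewtonTrees.IsYTrace (NewtonTrees.supp f) b →
        (∀ ℓ ∈ L, NewtonTrees.IsXTrace (NewtonTrees.supp ℓ.2) (n ℓ)) →
        -(T.multiplicity : ℝ) =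
          2 * NewtonTrees.areaFrom 0 (NewtonTrees.supp f ∪ {(a, 0), (0, b)}) - a - b +
            (L.map fun ℓ =>
              2 * NewtonTrees.areaFrom ℓ.1 (NewtonTrees.supp ℓ.2 ∪ {(n ℓ, 0)}) -
                ((n ℓ : ℝ) - ℓ.1)).sum := by
  have hred := NewtonTrees.logReduced_of_squarefree hf
  refine ⟨NewtonTrees.exists_isNewtonTree hred hf.ne_zero, fun T L ⟨es, hes, htop, hchain⟩ => ?_⟩
  obtain ⟨N, e, hform⟩ := NewtonTrees.exists_hasForm hf.ne_zero
  obtain ⟨hN, hY⟩ := NewtonTrees.hasForm_le_one_of_squarefree hf hform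
  obtain ⟨x', hc, hend⟩ := hform.exists_edgeChain hes
  have hedges : ∀ e ∈ es, NewtonTrees.IsEdge f e := fun e he => (hes.1 e).mp he
  refine ⟨hend.exists_isXTrace hY, hform.isEnd_swap.exists_isXTrace hN,
    hchain.exists_isXTrace hred hedges, fun a b n ha hb hn => ?_⟩
  have h1 := hchain.sum_eq hred hedges hc hn
  have h2 := hchain.topTerm_eq hc (htop.trans hform.ordX_eq)
  have h3 := hform.two_mul_areaFrom_zero hN hc hend hY ha hb
  have h4 : -(T.multiplicity : ℝ) = T.topTerm + T.body.sum := by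
    rw [NewtonTrees.NewtonTree.multiplicity]
    push_cast
    ring
  change _ = _ + (L.map (NewtonTrees.areaTerm n)).sum
  rw [h4, h1, h2, h3]
  -- Without edges the polygon has the single vertex `(N, e)` with `N, e ≤ 1`. The hypotheses
  -- exclude `(1, 0)` and `(0, 1)`, leaving a unit, with traces `0`, and `x * y` times a unit, where
  -- the doubled area is `a + b`.
  have hcor : es = [] → (N = 0 ↔ NewtonTrees.ordY f = 0) ∧ N = x' ∧ e = NewtonTrees.ordY f := by
    rintro rfl
    have h5 := hc.nil_eq
    refine ⟨⟨fun h0 => ?_, fun h0 => ?_⟩, h5⟩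
    · by_contra h6
      have h7 : NewtonTrees.ordY f = 1 := by omega
      rw [h0, h5.2, h7] at hform
      exact hy (NewtonTrees.associated_X1_of_ordY hform h7)
    · by_contra h6
      have h7 : N = 1 := by omega
      rw [h7, h5.2, h0] at hform
      exact hx (NewtonTrees.associated_X0_of_hasForm hform)
  by_cases h0 : es = []
  · obtain ⟨h7, h8, h9⟩ := hcor h0
    rcases hend.of_isXTrace hY ha with ⟨h5, h10⟩ | ⟨h5, -, -⟩ <;>
      rcases hform.isEnd_swap.of_isXTrace hN hb with ⟨h6, h11⟩ | ⟨h6, -, -⟩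
    · have h12 : a = 0 := by omega
      have h13 : b = 0 := by omega
      simp [h0, h5, h6, h12, h13]
    · omega
    · omega
    · simp [h0, h5, h6]
      ring
  -- On an axis that the polygon hits, the trace is the multiplicity of the dead end; on the other
  -- axes, the trace of the replaced edge cancels against its area.
  · rcases hend.of_isXTrace hY ha with ⟨h5, h10⟩ | ⟨h5, -, -⟩ <;>
      rcases hform.isEnd_swap.of_isXTrace hN hb with ⟨h6, h11⟩ | ⟨h6, -, -⟩
    · simp [h0, h5, h6, h10, h11]
      ring
    · simp [h0, h5, h6, h10]
      ring
    · simp [h0, h5, h6, h11]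
      ring
    · simp [h0, h5, h6]
      ring
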